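/- Let $p$ be a prime and let $K$ be a field of characteristic $0$, complete for a nonarchimedean absolute value normalized by $|p| = p^{-1}$, so that its residue field has characteristic $p$. Let $\Gamma^* \subset \mathbb{R}_{>0}$ be the divisible closure of $|K^*|$. A closed interval $I \subset (0,1)$ is called aligned if its endpoints lie in $\Gamma^*$; $A(I)$ denotes the annulus $|t| \in I$ over $K$, $\mathcal{O}$ the sheaf of rigid analytic functions, and $\mathfrak{o} \subset \mathcal{O}$ the subsheaf of functions bounded in absolute value by $1$ everywhere. Let $\sigma_K : K \to K$ be a continuous ring homomorphism inducing the $p$-th power map on the residue field, and let $\sigma$ be its standard extension $\left(\sum c_i t^i\right)^\sigma = \sum \sigma_K(c_i)\, t^{pi}$. A $\nabla$-module on $A[\epsilon,1)$ is a coherent locally free sheaf with a connection. For such an $\mathcal{E}$ and $\rho \in [\epsilon,1) \cap \Gamma^*$, choose a closed aligned interval $I \subset [\epsilon,1)$ containing $\rho$ and a basis of $\Gamma(\mathcal{E},A(I))$, let $D_s$ be the matrix of the $s$-th iterate of $d/dt$ in this basis, and set $$|T|_{\rho,\mathrm{sp}} = \max\Bigl\{p^{-1/(p-1)}\rho^{-1},\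 \limsup_{s\to\infty} \max_{i,j} |(D_s)_{ij}|_\rho^{1/s}\Bigr\}, \qquad R(\mathcal{E},\rho) = p^{-1/(p-1)}\,|T|_{\rho,\mathrm{sp}}^{-1},$$ where $\left|\sum c_i t^i\right|_\rho = \sup_i |c_i|\rho^i$; this does not depend on the choices. For a real number $\beta \ge 0$, one says that $\mathcal{E}$ has highest break $\beta$ if there is $\rho_0 \in (0,1)$ such that $R(\mathcal{E},\rho) = \rho^{\beta+1}$ for all $\rho \in (\rho_0,1) \cap \Gamma^*$. Proposition. Let $\epsilon \in (0,1) \cap \Gamma^*$, and let $\mathcal{E}$ be a $\nabla$-module on $A[\epsilon,1)$ equipped with a Frobenius structure for $\sigma$, that is, an isomorphism $F : \sigma^*\mathcal{E} \to \mathcal{E}$ of $\nabla$-modules over $A[\epsilon^{1/p},1)$. Suppose that for every closed aligned interval $I \subset [\epsilon,1)$ there is an $\mathfrak{o}$-lattice in $\Gamma(\mathcal{E},A(I))$ (a finitely generated $\Gamma(\mathfrak{o},A(I))$-submodule which generates $\Gamma(\mathcal{E},A(I))$ over $\Gamma(\mathcal{O},A(I))$) that is stable under $t\,\frac{d}{dt}$.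 If $\mathcal{E}$ has highest break $\beta$, then $$\beta \le \frac{1}{(p-1)\log_p(\epsilon^{-1})}.$$ -/

import Mathlib

open Filter Topology

universe u v

noncomputable section

namespace RigidAnnulus

/-! ### Conventions on the coefficient field -/

/-- The absolute value of the field `K` is normalized by `|p| = p⁻¹`. For a complete ultrametric
field this says that `K` has characteristic `0` and residue characteristic `p`. -/
class PAdicallyNormalized (p : ℕ) (K : Type*) [NormedField K] : Prop where
  norm_natCast : ‖(p : K)‖ = (p : ℝ)⁻¹

/-- The divisible closure, inside the positive reals, of the value group of `K`. -/
def divisibleValueGroup (K : Type*) [NormedField K] : Set ℝ :=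
  {r | 0 < r ∧ ∃ n : ℕ, 0 < n ∧ ∃ x : K, x ≠ 0 ∧ r ^ n = ‖x‖}

theorem pow_mem_divisibleValueGroup {K : Type*} [NormedField K] {r : ℝ}
    (hr : r ∈ divisibleValueGroup K) (p : ℕ) : r ^ p ∈ divisibleValueGroup K := by
  obtain ⟨h0, n, hn, x, hx, hxr⟩ := hr
  refine ⟨pow_pos h0 p, n, hn, x ^ p, pow_ne_zero p hx, ?_⟩
  rw [norm_pow, ← hxr, ← pow_mul, ← pow_mul, mul_comm]

/-- A continuous ring endomorphism of `K` which reduces to the `p`-power Frobenius on the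
residue field. -/
structure CoefficientFrobenius (p : ℕ) (K : Type*) [NormedField K] where
  toRingHom : K →+* K
  continuous_toRingHom : Continuous toRingHom
  norm_sub_pow_lt : ∀ x : K, ‖x‖ ≤ 1 → ‖toRingHom x - x ^ p‖ < 1

/-- A nonempty closed aligned interval `[left, right]` contained in `(0, 1)`. -/
structure ClosedInterval (K : Type*) [NormedField K] where
  left : ℝ
  right : ℝ
  left_pos : 0 < left
  left_le_right : left ≤ right
  right_lt_one : right < 1
  left_mem : left ∈ divisibleValueGroup K
  right_mem : right ∈ divisibleValueGroup K

/-- Inclusion of intervals. -/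
def ClosedInterval.Sub {K : Type*} [NormedField K] (I J : ClosedInterval K) : Prop :=
  J.left ≤ I.left ∧ I.right ≤ J.right

theorem ClosedInterval.Sub.refl {K : Type*} [NormedField K] (I : ClosedInterval K) : I.Sub I :=
  ⟨le_rfl, le_rfl⟩

theorem ClosedInterval.Sub.trans {K : Type*} [NormedField K] {I J L : ClosedInterval K}
    (h : I.Sub J) (h' : J.Sub L) : I.Sub L :=
  ⟨h'.1.trans h.1, h.2.trans h'.2⟩

/-- The interval `[a ^ p, b ^ p]` attached to `[a, b]`. -/
def ClosedInterval.pow {K : Type*} [NormedField K] (I : ClosedInterval K) (p : ℕ)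
    [Fact p.Prime] : ClosedInterval K where
  left := I.left ^ p
  right := I.right ^ p
  left_pos := pow_pos I.left_pos p
  left_le_right := pow_le_pow_left₀ I.left_pos.le I.left_le_right p
  right_lt_one := pow_lt_one₀ (I.left_pos.le.trans I.left_le_right) I.right_lt_one
    (Fact.out : p.Prime).ne_zero
  left_mem := pow_mem_divisibleValueGroup I.left_mem p
  right_mem := pow_mem_divisibleValueGroup I.right_mem p

theorem ClosedInterval.Sub.pow {K : Type*} [NormedField K] {I J : ClosedInterval K}
    (h : I.Sub J) (p : ℕ) [Fact p.Prime] : (I.pow p).Sub (J.pow p) :=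
  ⟨pow_le_pow_left₀ J.left_pos.le h.1 p,
    pow_le_pow_left₀ (I.left_pos.le.trans I.left_le_right) h.2 p⟩

theorem ClosedInterval.pow_left_le {K : Type*} [NormedField K] (I : ClosedInterval K) (p : ℕ)
    [Fact p.Prime] : (I.pow p).left ≤ I.left :=
  pow_le_of_le_one I.left_pos.le (I.left_le_right.trans I.right_lt_one.le)
    (Fact.out : p.Prime).ne_zero

/-! ### Laurent series and their convolution product -/

/-- The Laurent series `∑ cᵢ tⁱ` converges on the circle `|t| = r`. -/
def ConvergesAt {K : Type*} [NormedField K] (r : ℝ) (c : ℤ → K) : Prop :=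
  Tendsto (fun i : ℤ => ‖c i‖ * r ^ i) cofinite (𝓝 0)

/-- The coefficients of the product of two Laurent series. -/
def mulCoeff {K : Type*} [NormedField K] (f g : ℤ → K) (n : ℤ) : K :=
  ∑' i : ℤ, f i * g (n - i)

section Convolution

variable {K : Type*} [NormedField K] {r : ℝ} {f g h : ℤ → K}

theorem convergesAt_zero : ConvergesAt r (0 : ℤ → K) := by
  simp [ConvergesAt]

theorem ConvergesAt.neg (hf : ConvergesAt r f) : ConvergesAt r (-f) := by
  simpa [ConvergesAt] using hf

theorem ConvergesAt.add (hr : 0 < r) (hf : ConvergesAt r f) (hg : ConvergesAt r g) :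
    ConvergesAt r (f + g) := by
  have h0 := Tendsto.add hf hg
  rw [add_zero] at h0
  refine squeeze_zero (fun i => by positivity) (fun i => ?_) h0
  rw [← add_mul]
  exact mul_le_mul_of_nonneg_right (norm_add_le _ _) (by positivity)

theorem convergesAt_single (n : ℤ) (a : K) : ConvergesAt r (Pi.single n a) := by
  refine tendsto_nhds_of_eventually_eq ?_
  have : ({n}ᶜ : Set ℤ) ∈ cofinite := (Set.finite_singleton n).compl_mem_cofinite
  filter_upwards [this] with i hi
  have hi' : i ≠ n := hi
  simp [Pi.single_eq_of_ne hi']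

theorem tendsto_prod_norm (hf : ConvergesAt r f) (hg : ConvergesAt r g) :
    Tendsto (fun q : ℤ × ℤ => (‖f q.1‖ * r ^ q.1) * (‖g q.2‖ * r ^ q.2)) cofinite (𝓝 0) := by
  have key : ∀ {u : ℤ → ℝ}, Tendsto u cofinite (𝓝 0) → ∃ C, ∀ i, |u i| ≤ C := by
    intro u hu
    have h1 : {i | ¬ |u i| ≤ 1}.Finite := by
      have := hu.abs
      rw [abs_zero] at this
      exact this.eventually_le_const zero_lt_one
    obtain ⟨C, hC⟩ := (h1.image fun i => |u i|).bddAbove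
    refine ⟨max C 1, fun i => ?_⟩
    by_cases hi : |u i| ≤ 1
    · exact hi.trans (le_max_right _ _)
    · exact (hC ⟨i, hi, rfl⟩).trans (le_max_left _ _)
  obtain ⟨C, hC⟩ := key hf
  obtain ⟨D, hD⟩ := key hg
  have hC0 : 0 ≤ C := (abs_nonneg _).trans (hC 0)
  have hD0 : 0 ≤ D := (abs_nonneg _).trans (hD 0)
  rw [Metric.tendsto_nhds]
  intro ε hε
  have e1 : 0 < ε / (D + 1) := by positivity
  have e2 : 0 < ε / (C + 1) := by positivity
  have h1 := Metric.tendsto_nhds.1 hf _ e1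
  have h2 := Metric.tendsto_nhds.1 hg _ e2
  rw [eventually_cofinite] at h1 h2 ⊢
  refine (h1.prod h2).subset ?_
  rintro ⟨i, k⟩ hq
  simp only [Set.mem_ofPred_eq, dist_zero_right, Real.norm_eq_abs, Set.mem_prod] at hq ⊢
  refine ⟨fun hlt => hq ?_, fun hlt => hq ?_⟩
  · rw [abs_mul]
    calc |‖f i‖ * r ^ i| * |‖g k‖ * r ^ k|
        ≤ |‖f i‖ * r ^ i| * (D + 1) :=
          mul_le_mul_of_nonneg_left ((hD k).trans (by linarith)) (abs_nonneg _)
      _ < ε / (D + 1) * (D + 1) := mul_lt_mul_of_pos_right hlt (by linarith)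
      _ = ε := by field_simp
  · rw [abs_mul]
    calc |‖f i‖ * r ^ i| * |‖g k‖ * r ^ k|
        ≤ (C + 1) * |‖g k‖ * r ^ k| :=
          mul_le_mul_of_nonneg_right ((hC i).trans (by linarith)) (abs_nonneg _)
      _ < (C + 1) * (ε / (C + 1)) := mul_lt_mul_of_pos_left hlt (by linarith)
      _ = ε := by field_simp

theorem mulCoeff_comm (f g : ℤ → K) : mulCoeff f g = mulCoeff g f := by
  funext n
  unfold mulCoeff
  rw [← (Equiv.subLeft n).tsum_eq]
  refine tsum_congr fun i => ?_
  simp [mul_comm]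

theorem one_mulCoeff (f : ℤ → K) : mulCoeff (Pi.single 0 1) f = f := by
  funext n
  unfold mulCoeff
  rw [tsum_eq_single 0]
  · simp
  · intro i hi
    simp [Pi.single_eq_of_ne hi]

variable [IsUltrametricDist K]

theorem ConvergesAt.mul (hr : 0 < r) (hf : ConvergesAt r f) (hg : ConvergesAt r g) :
    ConvergesAt r (mulCoeff f g) := by
  have h0 := tendsto_prod_norm hf hg
  unfold ConvergesAt
  rw [Metric.tendsto_nhds] at h0 ⊢
  intro ε hε
  have h1 := h0 (ε / 2) (by positivity)
  rw [eventually_cofinite] at h1 ⊢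
  refine (h1.image fun q : ℤ × ℤ => q.1 + q.2).subset ?_
  intro n hn
  by_contra hn'
  apply hn
  have hb : ∀ i, ‖f i * g (n - i)‖ ≤ ε / 2 * r ^ (-n) := by
    intro i
    have hi : dist ((‖f i‖ * r ^ i) * (‖g (n - i)‖ * r ^ (n - i))) 0 < ε / 2 := by
      by_contra hcon
      exact hn' ⟨(i, n - i), hcon, by simp⟩
    rw [dist_zero_right, Real.norm_of_nonneg (by positivity)] at hi
    have e : ‖f i * g (n - i)‖
        = (‖f i‖ * r ^ i) * (‖g (n - i)‖ * r ^ (n - i)) * r ^ (-n) := by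
      have : r ^ i * r ^ (n - i) * r ^ (-n) = 1 := by
        rw [← zpow_add₀ hr.ne', ← zpow_add₀ hr.ne']; simp
      rw [norm_mul]
      linear_combination (-(‖f i‖ * ‖g (n - i)‖)) * this
    rw [e]
    exact mul_le_mul_of_nonneg_right hi.le (by positivity)
  have hs : ‖mulCoeff f g n‖ ≤ ε / 2 * r ^ (-n) :=
    IsUltrametricDist.norm_tsum_le_of_forall_le_of_nonneg (by positivity) hb
  rw [dist_zero_right, Real.norm_of_nonneg (by positivity)]
  calc ‖mulCoeff f g n‖ * r ^ n ≤ ε / 2 * r ^ (-n) * r ^ n :=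
        mul_le_mul_of_nonneg_right hs (by positivity)
    _ = ε / 2 := by rw [mul_assoc, ← zpow_add₀ hr.ne']; simp
    _ < ε := by linarith

variable [CompleteSpace K]

theorem summable_mulCoeff (hr : 0 < r) (hf : ConvergesAt r f) (hg : ConvergesAt r g) (n : ℤ) :
    Summable fun i : ℤ => f i * g (n - i) := by
  apply NonarchimedeanAddGroup.summable_of_tendsto_cofinite_zero
  rw [tendsto_zero_iff_norm_tendsto_zero]
  have hinj : Function.Injective fun i : ℤ => ((i, n - i) : ℤ × ℤ) :=
    fun a b hab => (Prod.ext_iff.1 hab).1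
  have h0 := ((tendsto_prod_norm hf hg).comp hinj.tendsto_cofinite).mul_const (r ^ (-n))
  rw [zero_mul] at h0
  refine h0.congr fun i => ?_
  have : r ^ i * r ^ (n - i) * r ^ (-n) = 1 := by
    rw [← zpow_add₀ hr.ne', ← zpow_add₀ hr.ne']; simp
  rw [norm_mul]
  simp only [Function.comp]
  linear_combination (‖f i‖ * ‖g (n - i)‖) * this

theorem mulCoeff_add (hr : 0 < r) (hf : ConvergesAt r f) (hg : ConvergesAt r g)
    (hh : ConvergesAt r h) : mulCoeff f (g + h) = mulCoeff f g + mulCoeff f h := by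
  funext n
  simp only [mulCoeff, Pi.add_apply, mul_add]
  exact (summable_mulCoeff hr hf hg n).tsum_add (summable_mulCoeff hr hf hh n)

theorem summable_triple (hr : 0 < r) (hf : ConvergesAt r f) (hg : ConvergesAt r g)
    (hh : ConvergesAt r h) (n : ℤ) :
    Summable (Function.uncurry fun i k : ℤ => f i * (g k * h (n - i - k))) := by
  apply NonarchimedeanAddGroup.summable_of_tendsto_cofinite_zero
  rw [tendsto_zero_iff_norm_tendsto_zero]
  have hb : ∃ C, ∀ i, ‖h i‖ * r ^ i ≤ C := by
    have h1 : {i | ¬ ‖h i‖ * r ^ i ≤ 1}.Finite := hh.eventually_le_const zero_lt_one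
    obtain ⟨C, hC⟩ := (h1.image fun i => ‖h i‖ * r ^ i).bddAbove
    refine ⟨max C 1, fun i => ?_⟩
    by_cases hi : ‖h i‖ * r ^ i ≤ 1
    · exact hi.trans (le_max_right _ _)
    · exact (hC ⟨i, hi, rfl⟩).trans (le_max_left _ _)
  obtain ⟨C, hC⟩ := hb
  have h0 := (tendsto_prod_norm hf hg).mul_const (C * r ^ (-n))
  rw [zero_mul] at h0
  refine squeeze_zero (fun _ => norm_nonneg _) (fun q => ?_) h0
  obtain ⟨i, k⟩ := q
  have : r ^ i * r ^ k * r ^ (n - i - k) * r ^ (-n) = 1 := by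
    rw [← zpow_add₀ hr.ne', ← zpow_add₀ hr.ne', ← zpow_add₀ hr.ne']; simp
  have e : ‖f i * (g k * h (n - i - k))‖ = (‖f i‖ * r ^ i) * (‖g k‖ * r ^ k) *
      ((‖h (n - i - k)‖ * r ^ (n - i - k)) * r ^ (-n)) := by
    rw [norm_mul, norm_mul]
    linear_combination (-(‖f i‖ * ‖g k‖ * ‖h (n - i - k)‖)) * this
  simp only [Function.uncurry]
  rw [e]
  have := hC (n - i - k)
  gcongr

theorem mulCoeff_assoc (hr : 0 < r) (hf : ConvergesAt r f) (hg : ConvergesAt r g)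
    (hh : ConvergesAt r h) : mulCoeff (mulCoeff f g) h = mulCoeff f (mulCoeff g h) := by
  funext n
  have hs := summable_triple hr hf hg hh n
  let e : ℤ × ℤ ≃ ℤ × ℤ :=
    { toFun := fun q => (q.1, q.2 - q.1)
      invFun := fun q => (q.1, q.2 + q.1)
      left_inv := fun q => by simp
      right_inv := fun q => by simp }
  have hs' : Summable (Function.uncurry fun i j : ℤ => f i * (g (j - i) * h (n - j))) := by
    refine ((e.summable_iff).2 hs).congr fun q => ?_
    simp only [e, Function.comp, Equiv.coe_fn_mk, Function.uncurry]
    congr 3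
    ring
  calc mulCoeff (mulCoeff f g) h n
      = ∑' j : ℤ, ∑' i : ℤ, f i * (g (j - i) * h (n - j)) := by
        refine tsum_congr fun j => ?_
        simp only [mulCoeff]
        rw [← tsum_mul_right]
        exact tsum_congr fun i => by ring
    _ = ∑' i : ℤ, ∑' j : ℤ, f i * (g (j - i) * h (n - j)) := hs'.tsum_comm
    _ = mulCoeff f (mulCoeff g h) n := by
        refine tsum_congr fun i => ?_
        simp only [mulCoeff]
        rw [← tsum_mul_left, ← (Equiv.addRight i).tsum_eq]
        refine tsum_congr fun k => ?_
        simp only [Equiv.coe_addRight, add_sub_cancel_right]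
        congr 3
        ring

end Convolution

/-! ### The ring of analytic functions on a closed annulus -/

section Ring

variable {K : Type*} [NormedField K]

/-- The coefficient families of the Laurent series which converge on the annulus `|t| ∈ I`. -/
def analyticCoeffs (I : ClosedInterval K) : AddSubgroup (ℤ → K) where
  carrier := {c | ∀ r ∈ Set.Icc I.left I.right, ConvergesAt r c}
  zero_mem' := fun _ _ => convergesAt_zero
  add_mem' := fun hf hg r hr => (hf r hr).add (I.left_pos.trans_le hr.1) (hg r hr)
  neg_mem' := fun hf r hr => (hf r hr).neg

/-- The ring of rigid analytic functions on the closed annulus `|t| ∈ I`, as Laurent series. -/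
def AnalyticRing (I : ClosedInterval K) : Type _ := analyticCoeffs I

instance AnalyticRing.instAddCommGroup (I : ClosedInterval K) : AddCommGroup (AnalyticRing I) :=
  inferInstanceAs (AddCommGroup (analyticCoeffs I))

namespace AnalyticRing

variable {I : ClosedInterval K}

/-- The `i`-th Laurent coefficient. -/
def coeff (f : AnalyticRing I) : ℤ → K := f.1

theorem convergesAt (f : AnalyticRing I) {r : ℝ} (hr : r ∈ Set.Icc I.left I.right) :
    ConvergesAt r f.coeff := f.2 r hr

/-- A Laurent series which converges on the annulus. -/
def mk (c : ℤ → K) (hc : ∀ r ∈ Set.Icc I.left I.right, ConvergesAt r c) : AnalyticRing I :=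
  ⟨c, hc⟩

@[simp] theorem coeff_mk (c : ℤ → K) (hc : ∀ r ∈ Set.Icc I.left I.right, ConvergesAt r c) :
    (mk c hc : AnalyticRing I).coeff = c := rfl

@[ext] theorem ext {f g : AnalyticRing I} (h : f.coeff = g.coeff) : f = g := Subtype.ext h

@[simp] theorem coeff_zero : (0 : AnalyticRing I).coeff = 0 := rfl

@[simp] theorem coeff_add (f g : AnalyticRing I) : (f + g).coeff = f.coeff + g.coeff := rfl

theorem left_mem_Icc (I : ClosedInterval K) : I.left ∈ Set.Icc I.left I.right :=
  ⟨le_rfl, I.left_le_right⟩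

instance : One (AnalyticRing I) := ⟨mk (Pi.single 0 1) fun _ _ => convergesAt_single 0 1⟩

@[simp] theorem coeff_one : (1 : AnalyticRing I).coeff = Pi.single 0 1 := rfl

variable [IsUltrametricDist K]

instance : Mul (AnalyticRing I) :=
  ⟨fun f g => mk (mulCoeff f.coeff g.coeff) fun _ hr =>
    (f.convergesAt hr).mul (I.left_pos.trans_le hr.1) (g.convergesAt hr)⟩

@[simp] theorem coeff_mul (f g : AnalyticRing I) :
    (f * g).coeff = mulCoeff f.coeff g.coeff := rfl

theorem mul_comm_aux (f g : AnalyticRing I) : f * g = g * f :=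
  ext (mulCoeff_comm f.coeff g.coeff)

theorem one_mul_aux (f : AnalyticRing I) : 1 * f = f := ext (one_mulCoeff f.coeff)

theorem derivCoeff_convergesAt (f : AnalyticRing I) {r : ℝ} (hr : r ∈ Set.Icc I.left I.right) :
    ConvergesAt r fun i => ((i + 1 : ℤ) : K) * f.coeff (i + 1) := by
  have hr0 : 0 < r := I.left_pos.trans_le hr.1
  have h0 := ((f.convergesAt hr).comp (add_left_injective (1 : ℤ)).tendsto_cofinite).mul_const
    r⁻¹
  rw [zero_mul] at h0
  refine squeeze_zero (fun i => by positivity) (fun i => ?_) h0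
  have h1 : ‖((i + 1 : ℤ) : K)‖ ≤ 1 := IsUltrametricDist.norm_intCast_le_one K _
  simp only [Function.comp, norm_mul]
  rw [zpow_add_one₀ hr0.ne']
  calc ‖((i + 1 : ℤ) : K)‖ * ‖f.coeff (i + 1)‖ * r ^ i
      ≤ 1 * ‖f.coeff (i + 1)‖ * r ^ i := by gcongr
    _ = ‖f.coeff (i + 1)‖ * (r ^ i * r) * r⁻¹ := by field_simp

variable [CompleteSpace K]

theorem mul_add_aux (f g h : AnalyticRing I) : f * (g + h) = f * g + f * h :=
  ext (mulCoeff_add I.left_pos (f.convergesAt (left_mem_Icc I)) (g.convergesAt (left_mem_Icc I))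
    (h.convergesAt (left_mem_Icc I)))

instance : CommRing (AnalyticRing I) where
  __ := instAddCommGroup I
  left_distrib := mul_add_aux
  right_distrib f g h := by
    rw [mul_comm_aux, mul_add_aux, mul_comm_aux h f, mul_comm_aux h g]
  zero_mul f := by
    have h := mul_add_aux f 0 0
    rw [add_zero] at h
    rw [mul_comm_aux]
    exact left_eq_add.1 h
  mul_zero f := by
    have h := mul_add_aux f 0 0
    rw [add_zero] at h
    exact left_eq_add.1 h
  mul_assoc f g h := ext (mulCoeff_assoc I.left_pos (f.convergesAt (left_mem_Icc I))
    (g.convergesAt (left_mem_Icc I)) (h.convergesAt (left_mem_Icc I)))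
  one_mul := one_mul_aux
  mul_one f := by rw [mul_comm_aux, one_mul_aux]
  mul_comm := mul_comm_aux

/-- The coordinate function `t`. -/
def coord (I : ClosedInterval K) : AnalyticRing I :=
  mk (Pi.single 1 1) fun _ _ => convergesAt_single 1 1

/-- The derivative `df/dt`. -/
def deriv (f : AnalyticRing I) : AnalyticRing I :=
  mk (fun i => ((i + 1 : ℤ) : K) * f.coeff (i + 1)) fun _ hr => f.derivCoeff_convergesAt hr

/-- The restriction of analytic functions to a smaller annulus. -/
def restrict {J : ClosedInterval K} (h : I.Sub J) : AnalyticRing J →+* AnalyticRing I where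
  toFun f := mk f.coeff fun _ hr => f.convergesAt ⟨h.1.trans hr.1, hr.2.trans h.2⟩
  map_one' := rfl
  map_mul' _ _ := rfl
  map_zero' := rfl
  map_add' _ _ := rfl

/-- The norm `|∑ cᵢ tⁱ|_ρ = sup |cᵢ| ρⁱ`. -/
def gaussNorm (ρ : ℝ) (f : AnalyticRing I) : ℝ := ⨆ i : ℤ, ‖f.coeff i‖ * ρ ^ i

/-- The analytic functions on the annulus `|t| ∈ I` which are bounded by `1` everywhere: those
with `|f|_ρ ≤ 1` for all `ρ` in `I`. -/
def integral (I : ClosedInterval K) : Subring (AnalyticRing I) where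
  carrier := {f | ∀ r ∈ Set.Icc I.left I.right, ∀ i, ‖f.coeff i‖ * r ^ i ≤ 1}
  zero_mem' := fun r _ i => by simp
  one_mem' := fun r _ i => by
    rcases eq_or_ne i 0 with rfl | hi
    · simp
    · simp [Pi.single_eq_of_ne hi]
  add_mem' := fun {f g} hf hg r hr i => by
    have hr0 : 0 < r := I.left_pos.trans_le hr.1
    rw [coeff_add, Pi.add_apply]
    calc ‖f.coeff i + g.coeff i‖ * r ^ i ≤ max ‖f.coeff i‖ ‖g.coeff i‖ * r ^ i := by
          gcongr
          exact IsUltrametricDist.norm_add_le_max _ _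
      _ ≤ 1 := by
          rcases max_choice ‖f.coeff i‖ ‖g.coeff i‖ with h | h <;> rw [h]
          exacts [hf r hr i, hg r hr i]
  neg_mem' := fun {f} hf r hr i => by
    have : (-f).coeff i = -f.coeff i := rfl
    rw [this, norm_neg]
    exact hf r hr i
  mul_mem' := fun {f g} hf hg r hr n => by
    have hr0 : 0 < r := I.left_pos.trans_le hr.1
    have hb : ∀ i, ‖f.coeff i * g.coeff (n - i)‖ ≤ r ^ (-n) := by
      intro i
      have e : ‖f.coeff i * g.coeff (n - i)‖
          = (‖f.coeff i‖ * r ^ i) * (‖g.coeff (n - i)‖ * r ^ (n - i)) * r ^ (-n) := by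
        have : r ^ i * r ^ (n - i) * r ^ (-n) = 1 := by
          rw [← zpow_add₀ hr0.ne', ← zpow_add₀ hr0.ne']; simp
        rw [norm_mul]
        linear_combination (-(‖f.coeff i‖ * ‖g.coeff (n - i)‖)) * this
      rw [e]
      refine mul_le_of_le_one_left (by positivity) ?_
      exact mul_le_one₀ (hf r hr i) (by positivity) (hg r hr (n - i))
    calc ‖mulCoeff f.coeff g.coeff n‖ * r ^ n ≤ r ^ (-n) * r ^ n := by
          gcongr
          exact IsUltrametricDist.norm_tsum_le_of_forall_le_of_nonneg (by positivity) hb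
      _ = 1 := by rw [← zpow_add₀ hr0.ne']; simp

end AnalyticRing

end Ring

/-! ### The standard Frobenius lift -/

section Frobenius

variable {p : ℕ} [Fact p.Prime] {K : Type*} [NormedField K]

/-- The coefficients of `∑ cᵢ^σ t^(p i)`. -/
def frobCoeff (σ : CoefficientFrobenius p K) (f : ℤ → K) (n : ℤ) : K :=
  if (p : ℤ) ∣ n then σ.toRingHom (f (n / p)) else 0

theorem frobCoeff_mul_p (σ : CoefficientFrobenius p K) (f : ℤ → K) (m : ℤ) :
    frobCoeff σ f (p * m) = σ.toRingHom (f m) := by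
  have hp0 : (p : ℤ) ≠ 0 := by exact_mod_cast (Fact.out : p.Prime).ne_zero
  rw [frobCoeff, if_pos (dvd_mul_right _ _), Int.mul_ediv_cancel_left _ hp0]

theorem frobCoeff_mulCoeff [IsUltrametricDist K] [CompleteSpace K]
    (σ : CoefficientFrobenius p K) {f g : ℤ → K} {r : ℝ} (hr : 0 < r)
    (hf : ConvergesAt r f) (hg : ConvergesAt r g) :
    frobCoeff σ (mulCoeff f g) = mulCoeff (frobCoeff σ f) (frobCoeff σ g) := by
  have hp0 : (p : ℤ) ≠ 0 := by exact_mod_cast (Fact.out : p.Prime).ne_zero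
  funext n
  by_cases hd : (p : ℤ) ∣ n
  · obtain ⟨m, rfl⟩ := hd
    rw [frobCoeff_mul_p]
    unfold mulCoeff
    rw [(summable_mulCoeff hr hf hg m).map_tsum σ.toRingHom σ.continuous_toRingHom]
    have hinj : Function.Injective fun i : ℤ => (p : ℤ) * i := mul_right_injective₀ hp0
    rw [← hinj.tsum_eq (f := fun i => frobCoeff σ f i * frobCoeff σ g (p * m - i))]
    · refine tsum_congr fun i => ?_
      rw [← mul_sub, frobCoeff_mul_p, frobCoeff_mul_p, map_mul]
    · intro i hi
      by_contra hcon
      apply hi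
      have : ¬ (p : ℤ) ∣ i := fun ⟨k, hk⟩ => hcon ⟨k, hk.symm⟩
      simp [frobCoeff, this]
  · have h0 : ∀ i, frobCoeff σ f i * frobCoeff σ g (n - i) = 0 := by
      intro i
      by_cases h1 : (p : ℤ) ∣ i
      · have : ¬ (p : ℤ) ∣ n - i := fun h2 => hd (by simpa using dvd_add h2 h1)
        rw [frobCoeff, frobCoeff, if_neg this, mul_zero]
      · rw [frobCoeff, if_neg h1, zero_mul]
    rw [frobCoeff, if_neg hd, mulCoeff, tsum_congr h0, tsum_zero]

variable [PAdicallyNormalized p K] [IsUltrametricDist K]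

theorem CoefficientFrobenius.norm_le (σ : CoefficientFrobenius p K) (x : K) :
    ‖σ.toRingHom x‖ ≤ ‖x‖ := by
  have hp : 1 < (p : ℝ) := by exact_mod_cast (Fact.out : p.Prime).one_lt
  have hpK : ‖(p : K)‖ = (p : ℝ)⁻¹ := PAdicallyNormalized.norm_natCast
  have hp0 : (p : K) ≠ 0 := by
    rw [← norm_ne_zero_iff, hpK]; positivity
  have small : ∀ y : K, ‖y‖ < 1 → ‖σ.toRingHom y‖ < 1 := by
    intro y hy
    have h1 := σ.norm_sub_pow_lt y hy.le
    have h2 : ‖y ^ p‖ < 1 := by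
      rw [norm_pow]
      exact pow_lt_one₀ (norm_nonneg _) hy (Fact.out : p.Prime).ne_zero
    calc ‖σ.toRingHom y‖ = ‖(σ.toRingHom y - y ^ p) + y ^ p‖ := by rw [sub_add_cancel]
      _ ≤ max ‖σ.toRingHom y - y ^ p‖ ‖y ^ p‖ := IsUltrametricDist.norm_add_le_max _ _
      _ < 1 := max_lt h1 h2
  by_contra! hlt
  rcases eq_or_ne x 0 with rfl | hx
  · simp at hlt
  have hx0 : 0 < ‖x‖ := norm_pos_iff.2 hx
  have hs0 : 0 < ‖σ.toRingHom x‖ := hx0.trans hlt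
  obtain ⟨n, hn⟩ := pow_unbounded_of_one_lt (p : ℝ) ((one_lt_div hx0).2 hlt)
  obtain ⟨m, hm1, hm2⟩ := exists_mem_Ico_zpow (pow_pos hx0 n) hp
  have hy : ‖x ^ n / (p : K) ^ (-(m + 1))‖ < 1 := by
    rw [norm_div, norm_pow, norm_zpow, hpK, inv_zpow', neg_neg]
    exact (div_lt_one (by positivity)).2 hm2
  have hy' := small _ hy
  rw [map_div₀, map_pow, map_zpow₀, map_natCast, norm_div, norm_pow, norm_zpow, hpK, inv_zpow',
    neg_neg, div_lt_one (by positivity), zpow_add_one₀ (by positivity)] at hy'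
  rw [div_pow, lt_div_iff₀ (by positivity)] at hn
  have : (p : ℝ) ^ m * p ≤ p * ‖x‖ ^ n := by
    rw [mul_comm]; gcongr
  linarith

theorem frobCoeff_convergesAt (σ : CoefficientFrobenius p K) {f : ℤ → K} {r : ℝ} (hr : 0 < r)
    (hf : ConvergesAt (r ^ p) f) : ConvergesAt r (frobCoeff σ f) := by
  have hp0 : (p : ℤ) ≠ 0 := by exact_mod_cast (Fact.out : p.Prime).ne_zero
  unfold ConvergesAt at hf ⊢
  rw [Metric.tendsto_nhds] at hf ⊢
  intro ε hε
  have h1 := hf ε hε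
  rw [eventually_cofinite] at h1 ⊢
  refine (h1.image fun m : ℤ => (p : ℤ) * m).subset ?_
  intro n hn
  by_cases hd : (p : ℤ) ∣ n
  · obtain ⟨m, rfl⟩ := hd
    refine ⟨m, fun hlt => hn ?_, rfl⟩
    rw [dist_zero_right, Real.norm_of_nonneg (by positivity)] at hlt ⊢
    rw [frobCoeff_mul_p]
    refine lt_of_le_of_lt ?_ hlt
    rw [zpow_mul, zpow_natCast]
    gcongr
    exact σ.norm_le _
  · exact absurd (by simp [frobCoeff, hd, hε]) hn

variable [CompleteSpace K]

/-- The standard extension `∑ cᵢ tⁱ ↦ ∑ cᵢ^σ t^(p i)`, from the functions on the annulus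
`|t| ∈ I ^ p` to those on the annulus `|t| ∈ I`. -/
def standardFrobenius (σ : CoefficientFrobenius p K) (I : ClosedInterval K) :
    AnalyticRing (I.pow p) →+* AnalyticRing I where
  toFun f := AnalyticRing.mk (frobCoeff σ f.coeff) fun r hr =>
    have hr0 : 0 < r := I.left_pos.trans_le hr.1
    frobCoeff_convergesAt σ hr0 (f.convergesAt
      ⟨pow_le_pow_left₀ I.left_pos.le hr.1 p, pow_le_pow_left₀ hr0.le hr.2 p⟩)
  map_one' := by
    have hp0 : (p : ℤ) ≠ 0 := by exact_mod_cast (Fact.out : p.Prime).ne_zero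
    ext n
    by_cases hd : (p : ℤ) ∣ n
    · obtain ⟨m, rfl⟩ := hd
      rw [AnalyticRing.coeff_mk, frobCoeff_mul_p]
      rcases eq_or_ne m 0 with rfl | hm
      · simp
      · have : (p : ℤ) * m ≠ 0 := mul_ne_zero hp0 hm
        simp [Pi.single_eq_of_ne hm, Pi.single_eq_of_ne this]
    · have : n ≠ 0 := by rintro rfl; exact hd (dvd_zero _)
      simp [frobCoeff, hd, Pi.single_eq_of_ne this]
  map_mul' f g := AnalyticRing.ext (frobCoeff_mulCoeff σ (I.pow p).left_pos
    (f.convergesAt (AnalyticRing.left_mem_Icc _)) (g.convergesAt (AnalyticRing.left_mem_Icc _)))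
  map_zero' := by
    ext n
    simp [frobCoeff]
  map_add' f g := by
    ext n
    by_cases hd : (p : ℤ) ∣ n <;> simp [frobCoeff, hd]

end Frobenius

/-! ### `∇`-modules -/

/-- The semilinear map `f : M → N` over `φ : R → S` exhibits `N` as the base change of `M`, that
is, `S ⊗[R] M → N` is bijective. -/
def IsSemilinearBaseChange {R S : Type*} [CommRing R] [CommRing S] (φ : R →+* S)
    {M N : Type*} [AddCommGroup M] [AddCommGroup N] [Module R M] [Module S N]
    (f : M →ₛₗ[φ] N) : Prop :=
  letI : Algebra R S := φ.toAlgebra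
  letI : Module R N := Module.compHom N φ
  haveI : IsScalarTower R S N := ⟨fun r s x => mul_smul (φ r) s x⟩
  IsBaseChange S
    ({ toFun := f
       map_add' := f.map_add
       map_smul' := f.map_smulₛₗ } : M →ₗ[R] N)

section NablaModule

/-- A `∇`-module on the annulus `A[ε, 1)`: a coherent locally free sheaf with a connection. It is
given by its modules of sections over the closed aligned subannuli `A(I)` (finitely generated and
projective), the restriction maps between them (which induce isomorphisms after base change), and
the action of `d/dt`. -/
structure NablaModule (K : Type u) [NormedField K] [IsUltrametricDist K] [CompleteSpace K]
    (ε : ℝ) where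
  /-- sections over `A(I)` -/
  sections : (I : ClosedInterval K) → ε ≤ I.left → Type v
  [addCommGroup : ∀ I h, AddCommGroup (sections I h)]
  [module : ∀ I h, Module (AnalyticRing I) (sections I h)]
  finite : ∀ I h, Module.Finite (AnalyticRing I) (sections I h)
  projective : ∀ I h, Module.Projective (AnalyticRing I) (sections I h)
  /-- restriction to a smaller closed annulus -/
  res : ∀ {I J : ClosedInterval K} (hJ : ε ≤ J.left) (hIJ : I.Sub J),
    sections J hJ →ₛₗ[AnalyticRing.restrict hIJ] sections I (hJ.trans hIJ.1)
  res_refl : ∀ {I : ClosedInterval K} (hI : ε ≤ I.left) (v : sections I hI),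
    res hI (.refl I) v = v
  res_res : ∀ {I J L : ClosedInterval K} (hL : ε ≤ L.left) (hJL : J.Sub L) (hIJ : I.Sub J)
    (v : sections L hL), res (hL.trans hJL.1) hIJ (res hL hJL v) = res hL (hIJ.trans hJL) v
  res_baseChange : ∀ {I J : ClosedInterval K} (hJ : ε ≤ J.left) (hIJ : I.Sub J),
    IsSemilinearBaseChange _ (res hJ hIJ)
  /-- the action of `d/dt` -/
  D : ∀ (I : ClosedInterval K) (hI : ε ≤ I.left), sections I hI →+ sections I hI
  leibniz : ∀ (I : ClosedInterval K) (hI : ε ≤ I.left) (f : AnalyticRing I)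
    (v : sections I hI), D I hI (f • v) = f.deriv • v + f • D I hI v
  D_res : ∀ {I J : ClosedInterval K} (hJ : ε ≤ J.left) (hIJ : I.Sub J) (v : sections J hJ),
    D I (hJ.trans hIJ.1) (res hJ hIJ v) = res hJ hIJ (D J hJ v)

attribute [instance] NablaModule.addCommGroup NablaModule.module

variable {K : Type u} [NormedField K] [IsUltrametricDist K] [CompleteSpace K] {ε : ℝ}

/-- A Frobenius structure on `E` over `A[ε^(1/p), 1)` for the standard lift `σ`, that is, an
isomorphism of `∇`-modules `σ^* E → E` there, written as a family of `σ`-linear maps. A closed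
subinterval `I = [a, b]` of `[ε^(1/p), 1)` is one with `ε ≤ a ^ p`, and the sections of `σ^* E`
over `A(I)` are the base change along `σ` of the sections of `E` over `A(I ^ p)`. -/
structure FrobeniusStructure {p : ℕ} [Fact p.Prime] [PAdicallyNormalized p K]
    (σ : CoefficientFrobenius p K) (E : NablaModule.{u, v} K ε) where
  F : ∀ (I : ClosedInterval K) (hI : ε ≤ (I.pow p).left),
    E.sections (I.pow p) hI →ₛₗ[standardFrobenius σ I]
      E.sections I (hI.trans (I.pow_left_le p))
  /-- the linearization is an isomorphism -/
  baseChange : ∀ (I : ClosedInterval K) (hI : ε ≤ (I.pow p).left),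
    IsSemilinearBaseChange _ (F I hI)
  F_res : ∀ {I J : ClosedInterval K} (hJ : ε ≤ (J.pow p).left) (hIJ : I.Sub J)
    (v : E.sections (J.pow p) hJ),
    F I (hJ.trans (hIJ.pow p).1) (E.res hJ (hIJ.pow p) v)
      = E.res (hJ.trans (J.pow_left_le p)) hIJ (F J hJ v)
  /-- compatibility with the connections: `d(t^p)/dt = p t^(p-1)` -/
  D_F : ∀ (I : ClosedInterval K) (hI : ε ≤ (I.pow p).left) (v : E.sections (I.pow p) hI),
    E.D I (hI.trans (I.pow_left_le p)) (F I hI v)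
      = ((p : AnalyticRing I) * AnalyticRing.coord I ^ (p - 1)) • F I hI (E.D (I.pow p) hI v)

namespace NablaModule

/-- An integral lattice in the sections of `E` over `A(I)`: a finitely generated submodule over
the ring of functions bounded by `1`, which generates the sections. -/
structure IsLattice (E : NablaModule.{u, v} K ε) (I : ClosedInterval K) (hI : ε ≤ I.left)
    (L : Submodule (AnalyticRing.integral I) (E.sections I hI)) : Prop where
  fg : L.FG
  span_eq_top : Submodule.span (AnalyticRing I) (L : Set (E.sections I hI)) = ⊤

/-- For every closed aligned subinterval `I` of `[ε, 1)`, the sections over `A(I)` contain an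
integral lattice stable under `t d/dt`. -/
def HasStableLattices (E : NablaModule.{u, v} K ε) : Prop :=
  ∀ (I : ClosedInterval K) (hI : ε ≤ I.left),
    ∃ L : Submodule (AnalyticRing.integral I) (E.sections I hI),
      E.IsLattice I hI L ∧ ∀ v ∈ L, AnalyticRing.coord I • E.D I hI v ∈ L

/-- `max |(D_s)_{ij}|_ρ` for the matrix `D_s` of the `s`-th iterate of `d/dt` in the basis `e`. -/
def iterateNorm (E : NablaModule.{u, v} K ε) {I : ClosedInterval K} {hI : ε ≤ I.left} {n : ℕ}
    (e : Module.Basis (Fin n) (AnalyticRing I) (E.sections I hI)) (ρ : ℝ) (s : ℕ) : ℝ :=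
  ⨆ q : Fin n × Fin n, (e.repr ((E.D I hI)^[s] (e q.2)) q.1).gaussNorm ρ

/-- The `ρ`-spectral norm of `d/dt`. -/
def spectralNorm (p : ℕ) (E : NablaModule.{u, v} K ε) {I : ClosedInterval K} {hI : ε ≤ I.left}
    {n : ℕ} (e : Module.Basis (Fin n) (AnalyticRing I) (E.sections I hI)) (ρ : ℝ) : ℝ :=
  max ((p : ℝ) ^ (-(1 / ((p : ℝ) - 1))) * ρ⁻¹)
    (limsup (fun s : ℕ => E.iterateNorm e ρ s ^ (1 / (s : ℝ))) atTop)

/-- `R` is the generic radius of convergence `R(E, ρ)`, computed in some basis of the sections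
over some closed subannulus `A(I)` with `ρ ∈ I`; it does not depend on these choices. -/
def IsGenericRadius (p : ℕ) (E : NablaModule.{u, v} K ε) (ρ R : ℝ) : Prop :=
  ∃ (I : ClosedInterval K) (hI : ε ≤ I.left) (n : ℕ)
    (e : Module.Basis (Fin n) (AnalyticRing I) (E.sections I hI)),
    ρ ∈ Set.Icc I.left I.right ∧
      R = (p : ℝ) ^ (-(1 / ((p : ℝ) - 1))) * (E.spectralNorm p e ρ)⁻¹

/-- `E` has highest break `≤ β`. -/
def HighestBreakLE (p : ℕ) (E : NablaModule.{u, v} K ε) (β : ℝ) : Prop :=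
  ∃ ρ₀ ∈ Set.Ioo (0 : ℝ) 1, ∀ ρ ∈ Set.Ioo ρ₀ 1 ∩ divisibleValueGroup K,
    ∃ R, E.IsGenericRadius p ρ R ∧ ρ ^ (β + 1) ≤ R

/-- `E` has highest break `≥ β`. -/
def HighestBreakGE (p : ℕ) (E : NablaModule.{u, v} K ε) (β : ℝ) : Prop :=
  ∃ ρ₀ ∈ Set.Ioo (0 : ℝ) 1, ∀ ρ ∈ Set.Ioo ρ₀ 1 ∩ divisibleValueGroup K,
    ∃ R, E.IsGenericRadius p ρ R ∧ R ≤ ρ ^ (β + 1)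

/-- `E` has highest break `β`. -/
def HasHighestBreak (p : ℕ) (E : NablaModule.{u, v} K ε) (β : ℝ) : Prop :=
  0 ≤ β ∧ E.HighestBreakLE p β ∧ E.HighestBreakGE p β

end NablaModule

end NablaModule

end RigidAnnulus

end

/-! Write `r₀ = p^(-1/(p-1))` (`expRadius`) and say that a module has radius at least `r` on `|t| =
ρ` when the coefficients of `D^s`, for `D = d/dt`, are `O(|s!| r^(-s))`.

A lattice stable under `t D` is stable under `t^s D^s`, so `D^s` is `O(ρ^(-s))`. Since `|s!| ≥
r₀^s`, the radius on `|t| = ε` is at least `r₀ ε` (`exists_iteratesBound_of_hasStableLattices`).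

Frobenius carries this outward. By Taylor expansion, `D^s(F v)` is a combination of the `F(D^j v)`
whose coefficients come from `((1+X)^p - 1)^j`. If `r₀ ≤ u ≤ 1`, the polynomial `(1+X)^p - 1` has
Gauss norm at most `u^p` on `|X| = u`, so radius `(uρ)^p` on `|t| = ρ^p` gives radius `uρ` on `|t| =
ρ` (`IteratesBound.frobenius`). After `k` applications, on `|t| = ρ = ε^(1/p^k)` the radius is at
least `uρ` with `u = r₀^(1/p^k)` (`exists_iteratesBound_of_pow_eq`).

For `k` large the break says that the radius there is at most `ρ^(β+1)`. Hence `u ≤ ρ^β`, and the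
`p^k`-th power is `r₀ ≤ ε^β` (`expRadius_le_rpow`), which is the claim after taking `log_p`.

The bounds are stated for finite generating families, because lattice generators need not form a
basis; `exists_iterateNorm_le` passes to the bases in which the spectral norm is computed. -/

noncomputable section

namespace RigidAnnulus

/-! ### Generating families and bases under semilinear base change. -/

section BaseChange

variable {R S : Type*} [CommRing R] [CommRing S] {φ : R →+* S} {M N : Type*} [AddCommGroup M]
  [AddCommGroup N] [Module R M] [Module S N] {f : M →ₛₗ[φ] N}

/-- Used both for restriction to a smaller annulus and for Frobenius. -/
theorem IsSemilinearBaseChange.span_range_eq_top (hf : IsSemilinearBaseChange φ f) {ι : Type*}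
    {e : ι → M} (he : Submodule.span R (Set.range e) = ⊤) :
    Submodule.span S (Set.range fun i => f (e i)) = ⊤ := by
  let _ : Algebra R S := φ.toAlgebra
  let _ : Module R N := Module.compHom N φ
  have : IsScalarTower R S N := ⟨fun r s x => mul_smul (φ r) s x⟩
  -- The local instances repeat those in the definition of `IsSemilinearBaseChange`, so `hf` has
  -- this type by unfolding.
  have h : IsBaseChange S
    ({ toFun := f
       map_add' := f.map_add
       map_smul' := f.map_smulₛₗ } : M →ₗ[R] N) := hf
  have hmem : ∀ m : M, f m ∈ Submodule.span S (Set.range fun i => f (e i)) := by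
    intro m
    have hm : m ∈ Submodule.span R (Set.range e) := he ▸ Submodule.mem_top
    induction hm using Submodule.span_induction with
    | mem x hx =>
      obtain ⟨i, rfl⟩ := hx
      exact Submodule.subset_span ⟨i, rfl⟩
    | zero => rw [map_zero]; exact zero_mem _
    | add x y _ _ hx hy => rw [map_add]; exact add_mem hx hy
    | smul a x _ hx => rw [map_smulₛₗ]; exact Submodule.smul_mem _ _ hx
  refine Submodule.eq_top_iff'.2 fun x => ?_
  exact h.inductionOn x (· ∈ Submodule.span S (Set.range fun i => f (e i))) (zero_mem _) hmem
    (fun s n hn => Submodule.smul_mem _ s hn) fun _ _ h₁ h₂ => add_mem h₁ h₂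

theorem IsSemilinearBaseChange.linearIndependent (hf : IsSemilinearBaseChange φ f) {ι : Type*}
    (b : Module.Basis ι R M) : LinearIndependent S fun i => f (b i) := by
  let _ : Algebra R S := φ.toAlgebra
  let _ : Module R N := Module.compHom N φ
  have : IsScalarTower R S N := ⟨fun r s x => mul_smul (φ r) s x⟩
  have h : IsBaseChange S
    ({ toFun := f
       map_add' := f.map_add
       map_smul' := f.map_smulₛₗ } : M →ₗ[R] N) := hf
  have h' : (fun i => f (b i)) = h.basis b := by
    funext i
    rw [h.basis_apply b i]
    rfl
  rw [h']
  exact (h.basis b).linearIndependent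

end BaseChange

/-! ### Absolute values of factorials. -/

section Factorial

variable (p : ℕ) [Fact p.Prime] (K : Type*) [NormedField K] [IsUltrametricDist K]
  [PAdicallyNormalized p K]

/-- An integer `m` prime to `p` has norm `1`: otherwise both terms of a Bézout relation `a m + b p =
1` would have norm less than `1`. -/
theorem norm_natCast_eq {n : ℕ} (hn : n ≠ 0) :
    ‖(n : K)‖ = ((p : ℝ)⁻¹) ^ padicValNat p n := by
  have hp : p.Prime := Fact.out
  obtain ⟨k, m, hm, hnm⟩ := Nat.exists_eq_pow_mul_and_not_dvd hn p hp.ne_one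
  have hm1 : ‖(m : K)‖ = 1 := by
    refine le_antisymm (IsUltrametricDist.norm_natCast_le_one K m) ?_
    have hc : IsCoprime (m : ℤ) p :=
      Nat.isCoprime_iff_coprime.2 ((hp.coprime_iff_not_dvd.2 hm).symm)
    obtain ⟨a, b, hab⟩ := hc
    have hK : (a : K) * m + b * p = 1 := by exact_mod_cast congrArg (Int.cast : ℤ → K) hab
    by_contra! hlt
    have h1 : ‖(a : K) * m‖ < 1 := by
      rw [norm_mul]
      exact (mul_le_of_le_one_left (norm_nonneg _)
        (IsUltrametricDist.norm_intCast_le_one K a)).trans_lt hlt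
    have h2 : ‖(b : K) * p‖ < 1 := by
      rw [norm_mul, PAdicallyNormalized.norm_natCast]
      refine (mul_le_of_le_one_left (by positivity)
        (IsUltrametricDist.norm_intCast_le_one K b)).trans_lt ?_
      exact inv_lt_one_of_one_lt₀ (by exact_mod_cast hp.one_lt)
    have h3 := (IsUltrametricDist.norm_add_le_max ((a : K) * m) (b * p)).trans_lt (max_lt h1 h2)
    rw [hK, norm_one] at h3
    exact lt_irrefl _ h3
  have hm0 : m ≠ 0 := by rintro rfl; exact hm (dvd_zero p)
  have hval : padicValNat p n = k := by
    rw [hnm, padicValNat.mul (pow_ne_zero _ hp.ne_zero) hm0, padicValNat.prime_pow,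
      padicValNat.eq_zero_of_not_dvd hm, add_zero]
  rw [hval, hnm, Nat.cast_mul, Nat.cast_pow, norm_mul, norm_pow, hm1, mul_one,
    PAdicallyNormalized.norm_natCast]

/-- The radius `p^(-1/(p-1))` of convergence of the exponential series. -/
def expRadius : ℝ := (p : ℝ) ^ (-(1 / ((p : ℝ) - 1)))

theorem expRadius_pos : 0 < expRadius p :=
  Real.rpow_pos_of_pos (by exact_mod_cast (Fact.out : p.Prime).pos) _

theorem expRadius_pow : expRadius p ^ (p - 1) = (p : ℝ)⁻¹ := by
  have hp : p.Prime := Fact.out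
  have h1 : (1 : ℝ) < p := by exact_mod_cast hp.one_lt
  rw [expRadius, ← Real.rpow_natCast, ← Real.rpow_mul (by positivity), Nat.cast_sub hp.one_le,
    Nat.cast_one, neg_mul, one_div, inv_mul_cancel₀ (by linarith), Real.rpow_neg_one]

theorem expRadius_le_one : expRadius p ≤ 1 := by
  have h1 : (1 : ℝ) < p := by exact_mod_cast (Fact.out : p.Prime).one_lt
  exact Real.rpow_le_one_of_one_le_of_nonpos h1.le
    (neg_nonpos.2 (one_div_nonneg.2 (by linarith)))

/-- Legendre's formula. The power `p - 1` keeps all exponents integral; the two bounds below are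
compared after raising to it. -/
theorem norm_factorial_pow (s : ℕ) : ‖((s.factorial : ℕ) : K)‖ ^ (p - 1) =
    ((p : ℝ)⁻¹) ^ (s - (p.digits s).sum) := by
  rw [norm_natCast_eq p K s.factorial_ne_zero, ← pow_mul, mul_comm,
    sub_one_mul_padicValNat_factorial]

theorem expRadius_pow_le_norm_factorial (s : ℕ) :
    expRadius p ^ s ≤ ‖((s.factorial : ℕ) : K)‖ := by
  have hp : p.Prime := Fact.out
  have h1 : (1 : ℝ) < p := by exact_mod_cast hp.one_lt
  refine le_of_pow_le_pow_left₀ (Nat.sub_pos_of_lt hp.one_lt).ne' (norm_nonneg _) ?_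
  rw [norm_factorial_pow p K, ← pow_mul, mul_comm, pow_mul, expRadius_pow]
  exact pow_le_pow_of_le_one (by positivity) (inv_le_one_of_one_le₀ h1.le) (Nat.sub_le _ _)

/-- The digit sum of `s` is at most `(p-1)(⌊log_p s⌋ + 1)`, so the loss against `expRadius p ^ s` is
only linear in `s` and disappears on taking `s`-th roots. -/
theorem norm_factorial_le {s : ℕ} (hs : s ≠ 0) :
    ‖((s.factorial : ℕ) : K)‖ ≤ p * s * expRadius p ^ s := by
  have hp : p.Prime := Fact.out
  have h1 : (1 : ℝ) < p := by exact_mod_cast hp.one_lt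
  have h0 : (p : ℝ) ≠ 0 := by positivity
  have hr := expRadius_pos p
  refine le_of_pow_le_pow_left₀ (Nat.sub_pos_of_lt hp.one_lt).ne' (by positivity) ?_
  rw [norm_factorial_pow p K, mul_pow, ← pow_mul _ s, mul_comm s, pow_mul _ _ s, expRadius_pow]
  have hd : (p.digits s).sum ≤ (Nat.log p s + 1) * (p - 1) := by
    have := List.sum_le_card_nsmul (p.digits s) (p - 1) fun x hx =>
      Nat.le_sub_one_of_lt (Nat.digits_lt_base hp.one_lt hx)
    rwa [Nat.length_digits p s hp.one_lt hs, smul_eq_mul] at this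
  have hd' : (p : ℝ) ^ (p.digits s).sum ≤ (p * s : ℝ) ^ (p - 1) := by
    calc (p : ℝ) ^ (p.digits s).sum ≤ (p : ℝ) ^ ((Nat.log p s + 1) * (p - 1)) :=
          pow_le_pow_right₀ h1.le hd
      _ = ((p : ℝ) * p ^ Nat.log p s) ^ (p - 1) := by rw [pow_mul, pow_succ']
      _ ≤ _ := by
          gcongr
          exact_mod_cast Nat.pow_log_le_self p hs
  rw [inv_pow, inv_pow]
  have hs' : (p.digits s).sum ≤ s := Nat.digit_sum_le p s
  calc ((p : ℝ) ^ (s - (p.digits s).sum))⁻¹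
      = (p : ℝ) ^ (p.digits s).sum * ((p : ℝ) ^ s)⁻¹ := by
        rw [pow_sub₀ _ h0 hs', mul_inv, inv_inv, mul_comm]
    _ ≤ _ := by gcongr

end Factorial

/-! ### Gauss norm estimates and monomials. -/

namespace AnalyticRing

variable {K : Type*} [NormedField K] {I : ClosedInterval K}

/-- The bound `|f|_ρ ≤ A`. -/
def NormLE (ρ : ℝ) (f : AnalyticRing I) (A : ℝ) : Prop := ∀ i : ℤ, ‖f.coeff i‖ * ρ ^ i ≤ A

theorem exists_normLE (f : AnalyticRing I) {ρ : ℝ} (hρ : ρ ∈ Set.Icc I.left I.right) :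
    ∃ A, f.NormLE ρ A := by
  have h1 : {i | ¬ ‖f.coeff i‖ * ρ ^ i ≤ 1}.Finite :=
    (f.convergesAt hρ).eventually_le_const zero_lt_one
  obtain ⟨C, hC⟩ := (h1.image fun i => ‖f.coeff i‖ * ρ ^ i).bddAbove
  refine ⟨max C 1, fun i => ?_⟩
  by_cases hi : ‖f.coeff i‖ * ρ ^ i ≤ 1
  · exact hi.trans (le_max_right _ _)
  · exact (hC ⟨i, hi, rfl⟩).trans (le_max_left _ _)

theorem NormLE.gaussNorm_le {ρ A : ℝ} {f : AnalyticRing I} (hf : f.NormLE ρ A) :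
    f.gaussNorm ρ ≤ A := ciSup_le hf

theorem NormLE.mono {ρ A B : ℝ} {f : AnalyticRing I} (hf : f.NormLE ρ A) (h : A ≤ B) :
    f.NormLE ρ B := fun i => (hf i).trans h

theorem NormLE.nonneg {ρ A : ℝ} {f : AnalyticRing I} (hf : f.NormLE ρ A) : 0 ≤ A := by
  refine le_trans ?_ (hf 0)
  simp

theorem normLE_zero {ρ A : ℝ} (hA : 0 ≤ A) : (0 : AnalyticRing I).NormLE ρ A := fun i => by
  simpa using hA

/-- The monomial `a tⁿ`. -/
def monomial (n : ℤ) (a : K) : AnalyticRing I :=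
  mk (Pi.single n a) fun _ _ => convergesAt_single n a

@[simp] theorem coeff_monomial (n : ℤ) (a : K) :
    (monomial n a : AnalyticRing I).coeff = Pi.single n a := rfl

theorem normLE_monomial {ρ : ℝ} (hρ : 0 ≤ ρ) (n : ℤ) (a : K) :
    (monomial n a : AnalyticRing I).NormLE ρ (‖a‖ * ρ ^ n) := fun i => by
  rcases eq_or_ne i n with rfl | hi
  · simp
  · simp [Pi.single_eq_of_ne hi]
    positivity

theorem monomial_add (n : ℤ) (a b : K) :
    (monomial n (a + b) : AnalyticRing I) = monomial n a + monomial n b :=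
  ext (Pi.single_add (f := fun _ : ℤ => K) n a b)

theorem monomial_zero_right (n : ℤ) : (monomial n (0 : K) : AnalyticRing I) = 0 :=
  ext (Pi.single_zero (M := fun _ : ℤ => K) n)

theorem monomial_zero_one : (monomial 0 1 : AnalyticRing I) = 1 := rfl

theorem monomial_one_one : (monomial 1 1 : AnalyticRing I) = coord I := rfl

variable [IsUltrametricDist K]

theorem monomial_mul_monomial (n m : ℤ) (a b : K) :
    (monomial n a * monomial m b : AnalyticRing I) = monomial (n + m) (a * b) := by
  ext i
  rw [coeff_mul, coeff_monomial, coeff_monomial, coeff_monomial, mulCoeff,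
    tsum_eq_single n fun j hj => by rw [Pi.single_eq_of_ne hj, zero_mul], Pi.single_eq_same]
  rcases eq_or_ne i (n + m) with rfl | hi
  · simp
  · rw [Pi.single_eq_of_ne hi, Pi.single_eq_of_ne (by omega), mul_zero]

theorem deriv_monomial (n : ℤ) (a : K) :
    (monomial n a : AnalyticRing I).deriv = monomial (n - 1) (n * a) := by
  ext i
  simp only [deriv, coeff_mk, coeff_monomial]
  rcases eq_or_ne i (n - 1) with rfl | hi
  · simp
  · rw [Pi.single_eq_of_ne hi, Pi.single_eq_of_ne (by omega), mul_zero]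

theorem coeff_deriv_iterate (f : AnalyticRing I) (a : ℕ) (i : ℤ) :
    (deriv^[a] f).coeff i =
      ((∏ k ∈ Finset.range a, (i + 1 + k) : ℤ) : K) * f.coeff (i + a) := by
  induction a generalizing i with
  | zero => simp
  | succ a ih =>
    rw [Function.iterate_succ_apply']
    change ((i + 1 : ℤ) : K) * (deriv^[a] f).coeff (i + 1) = _
    rw [ih, Finset.prod_range_succ', Nat.cast_zero, add_zero, mul_comm (∏ k ∈ _, _) (i + 1),
      Int.cast_mul, mul_assoc]
    have h1 : ∏ k ∈ Finset.range a, (i + 1 + 1 + (k : ℤ)) =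
        ∏ k ∈ Finset.range a, (i + 1 + ((k + 1 : ℕ) : ℤ)) :=
      Finset.prod_congr rfl fun k _ => by push_cast; ring
    rw [h1, Nat.cast_succ, add_right_comm i 1, add_assoc i]

theorem NormLE.add {ρ A : ℝ} (hρ : 0 ≤ ρ) {f g : AnalyticRing I} (hf : f.NormLE ρ A)
    (hg : g.NormLE ρ A) : (f + g).NormLE ρ A := fun i => by
  rw [coeff_add, Pi.add_apply]
  calc ‖f.coeff i + g.coeff i‖ * ρ ^ i ≤ max ‖f.coeff i‖ ‖g.coeff i‖ * ρ ^ i := by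
        gcongr
        exact IsUltrametricDist.norm_add_le_max _ _
    _ ≤ A := by
        rcases max_choice ‖f.coeff i‖ ‖g.coeff i‖ with h | h <;> rw [h]
        exacts [hf i, hg i]

theorem NormLE.mul {ρ A B : ℝ} (hρ : 0 < ρ) {f g : AnalyticRing I} (hf : f.NormLE ρ A)
    (hg : g.NormLE ρ B) : (f * g).NormLE ρ (A * B) := fun n => by
  have hA := hf.nonneg
  have hB := hg.nonneg
  have hb : ∀ i, ‖f.coeff i * g.coeff (n - i)‖ ≤ A * B * ρ ^ (-n) := by
    intro i
    have e : ‖f.coeff i * g.coeff (n - i)‖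
        = (‖f.coeff i‖ * ρ ^ i) * (‖g.coeff (n - i)‖ * ρ ^ (n - i)) * ρ ^ (-n) := by
      have : ρ ^ i * ρ ^ (n - i) * ρ ^ (-n) = 1 := by
        rw [← zpow_add₀ hρ.ne', ← zpow_add₀ hρ.ne']; simp
      rw [norm_mul]
      linear_combination (-(‖f.coeff i‖ * ‖g.coeff (n - i)‖)) * this
    rw [e]
    gcongr
    exacts [hf i, hg (n - i)]
  calc ‖mulCoeff f.coeff g.coeff n‖ * ρ ^ n ≤ A * B * ρ ^ (-n) * ρ ^ n := by
        gcongr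
        exact IsUltrametricDist.norm_tsum_le_of_forall_le_of_nonneg (by positivity) hb
    _ = A * B := by rw [mul_assoc, ← zpow_add₀ hρ.ne']; simp

/-- The `a`-th derivative multiplies coefficients by products of `a` consecutive integers, which are
divisible by `a!`. The factor `|a!|` gained here is what the Leibniz estimate in
`IteratesBound.smul` needs. -/
theorem NormLE.deriv_iterate {ρ A : ℝ} (hρ : 0 < ρ) {f : AnalyticRing I} (hf : f.NormLE ρ A)
    (a : ℕ) : (AnalyticRing.deriv^[a] f).NormLE ρ (‖((a.factorial : ℕ) : K)‖ * ρ ^ (-a : ℤ) * A) :=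
    fun i => by
  rw [coeff_deriv_iterate]
  obtain ⟨c, hc⟩ := Nat.factorial_coe_dvd_prod a (i + 1)
  rw [hc, Int.cast_mul, Int.cast_natCast, norm_mul, norm_mul]
  have h := hf (i + a)
  have hcn : ‖(c : K)‖ ≤ 1 := IsUltrametricDist.norm_intCast_le_one K c
  have e : ρ ^ i = ρ ^ (-a : ℤ) * ρ ^ (i + a) := by
    rw [← zpow_add₀ hρ.ne']; congr 1; ring
  calc ‖((a.factorial : ℕ) : K)‖ * ‖(c : K)‖ * ‖f.coeff (i + a)‖ * ρ ^ i
      = ‖((a.factorial : ℕ) : K)‖ * ρ ^ (-a : ℤ) *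
          (‖(c : K)‖ * (‖f.coeff (i + a)‖ * ρ ^ (i + a))) := by rw [e]; ring
    _ ≤ ‖((a.factorial : ℕ) : K)‖ * ρ ^ (-a : ℤ) * (1 * A) := by gcongr
    _ = _ := by rw [one_mul]

variable [CompleteSpace K]

theorem coord_pow (n : ℕ) : coord I ^ n = monomial n 1 := by
  induction n with
  | zero => rw [pow_zero]; rfl
  | succ n ih =>
    rw [pow_succ, ih, ← monomial_one_one, monomial_mul_monomial, mul_one, Nat.cast_succ]

theorem natCast_eq_monomial (n : ℕ) : (n : AnalyticRing I) = monomial 0 (n : K) := by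
  induction n with
  | zero => rw [Nat.cast_zero, Nat.cast_zero, monomial_zero_right]
  | succ n ih => rw [Nat.cast_succ, ih, Nat.cast_succ, monomial_add]; rfl

end AnalyticRing

/-! ### Bounded combinations -/

section Box

variable {K : Type*} [NormedField K] [IsUltrametricDist K] [CompleteSpace K]
  {M : Type*} [AddCommGroup M] {ι κ : Type*} [Fintype ι] [Fintype κ]

/-- The combinations of the family `e` whose coefficients satisfy `|c|_ρ ≤ A`. -/
def BoundedCombination (I : ClosedInterval K) [Module (AnalyticRing I) M] (ρ : ℝ) (e : ι → M) (A : ℝ) (v : M) : Prop :=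
  ∃ c : ι → AnalyticRing I, (∀ i, (c i).NormLE ρ A) ∧ v = ∑ i, c i • e i

namespace BoundedCombination

variable {I : ClosedInterval K} [Module (AnalyticRing I) M] {ρ : ℝ} {e : ι → M} {A B : ℝ} {v w : M}

theorem mono (hv : BoundedCombination I ρ e A v) (h : A ≤ B) : BoundedCombination I ρ e B v := by
  obtain ⟨c, hc, rfl⟩ := hv
  exact ⟨c, fun i => (hc i).mono h, rfl⟩

theorem zero (e : ι → M) (hA : 0 ≤ A) : BoundedCombination I ρ e A 0 :=
  ⟨0, fun _ => AnalyticRing.normLE_zero hA, by simp⟩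

theorem add (hρ : 0 ≤ ρ) (hv : BoundedCombination I ρ e A v) (hw : BoundedCombination I ρ e A w) :
    BoundedCombination I ρ e A (v + w) := by
  obtain ⟨c, hc, rfl⟩ := hv
  obtain ⟨d, hd, rfl⟩ := hw
  exact ⟨c + d, fun i => (hc i).add hρ (hd i), by
    simp only [Pi.add_apply, add_smul, Finset.sum_add_distrib]⟩

theorem sum (hρ : 0 ≤ ρ) (hA : 0 ≤ A) {τ : Type*} (s : Finset τ) {f : τ → M}
    (hf : ∀ i ∈ s, BoundedCombination I ρ e A (f i)) : BoundedCombination I ρ e A (∑ i ∈ s, f i) :=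
  Finset.sum_induction f (BoundedCombination I ρ e A) (fun _ _ => add hρ) (zero e hA) hf

theorem smul (hρ : 0 < ρ) {g : AnalyticRing I} (hg : g.NormLE ρ B)
    (hv : BoundedCombination I ρ e A v) : BoundedCombination I ρ e (B * A) (g • v) := by
  obtain ⟨c, hc, rfl⟩ := hv
  exact ⟨fun i => g * c i, fun i => hg.mul hρ (hc i), by simp only [Finset.smul_sum, mul_smul]⟩

theorem trans (hρ : 0 < ρ) {e' : κ → M} (hA : 0 ≤ A) (hB : 0 ≤ B)
    (hv : BoundedCombination I ρ e A v)
    (he : ∀ i, BoundedCombination I ρ e' B (e i)) : BoundedCombination I ρ e' (A * B) v := by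
  obtain ⟨c, hc, rfl⟩ := hv
  exact sum hρ.le (by positivity) _ fun i _ => (he i).smul hρ (hc i)

/-- In a generating family, every finite family has uniformly bounded coefficients. -/
theorem exists_of_span_eq_top (hρ : ρ ∈ Set.Icc I.left I.right)
    (he : Submodule.span (AnalyticRing I) (Set.range e) = ⊤) (w : κ → M) :
    ∃ B, 0 ≤ B ∧ ∀ k, BoundedCombination I ρ e B (w k) := by
  have h1 : ∀ k, ∃ c : ι → AnalyticRing I, ∑ i, c i • e i = w k := fun k =>
    (Submodule.mem_span_range_iff_exists_fun _).1 (he ▸ Submodule.mem_top)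
  choose c hc using h1
  choose A hA using fun k i => (c k i).exists_normLE hρ
  refine ⟨∑ k, ∑ i, A k i, Finset.sum_nonneg fun k _ => Finset.sum_nonneg fun i _ =>
    (hA k i).nonneg, fun k => ⟨c k, fun i => (hA k i).mono ?_, (hc k).symm⟩⟩
  exact (Finset.single_le_sum (f := A k) (fun j _ => (hA k j).nonneg) (Finset.mem_univ i)).trans
    (Finset.single_le_sum (f := fun k => ∑ i, A k i)
      (fun j _ => Finset.sum_nonneg fun i _ => (hA j i).nonneg) (Finset.mem_univ k))

end BoundedCombination

end Box

/-! ### Growth of the iterates of a derivation. -/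

section Iterates

variable {K : Type*} [NormedField K] [IsUltrametricDist K] [CompleteSpace K]
  {M : Type*} [AddCommGroup M] {ι κ : Type*} [Fintype ι] [Fintype κ]

/-- The iterates of `D` on `v` grow at most as for a radius of convergence `r`, with respect to
the family `e` and the norm `|·|_ρ`. -/
def IteratesBound (I : ClosedInterval K) [Module (AnalyticRing I) M] (D : M →+ M) (e : ι → M)
    (ρ r C : ℝ) (v : M) : Prop :=
  ∀ s : ℕ, BoundedCombination I ρ e (C * ‖((s.factorial : ℕ) : K)‖ * r ^ (-s : ℤ)) (D^[s] v)

variable {I : ClosedInterval K} [Module (AnalyticRing I) M] {D : M →+ M} {e : ι → M}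
  {ρ r C : ℝ}

theorem iterate_smul_eq_sum
    (hD : ∀ (f : AnalyticRing I) (v : M), D (f • v) = f.deriv • v + f • D v)
    (f : AnalyticRing I) (v : M) (s : ℕ) :
    D^[s] (f • v) = ∑ ij ∈ Finset.HasAntidiagonal.antidiagonal s,
      s.choose ij.1 • (AnalyticRing.deriv^[ij.1] f • D^[ij.2] v) := by
  induction s with
  | zero => simp
  | succ s ih =>
    -- Pascal's rule, in summed form.
    rw [Finset.sum_antidiagonal_choose_succ_nsmul
      (fun i j => AnalyticRing.deriv^[i] f • D^[j] v) s]
    simp only [Function.iterate_succ_apply', ih, map_sum, map_nsmul, hD, smul_add,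
      Finset.sum_add_distrib]
    rw [add_comm, add_right_inj]
    refine Finset.sum_congr rfl fun ⟨i, j⟩ hij => ?_
    rw [s.choose_symm_of_eq_add (Finset.HasAntidiagonal.mem_antidiagonal.1 hij).symm]

theorem IteratesBound.sum {τ : Type*} (t : Finset τ) {v : τ → M} (hρ : 0 ≤ ρ) (hr : 0 < r)
    (hC : 0 ≤ C) (hv : ∀ i ∈ t, IteratesBound I D e ρ r C (v i)) :
    IteratesBound I D e ρ r C (∑ i ∈ t, v i) := fun s => by
  have h : D^[s] (∑ i ∈ t, v i) = ∑ i ∈ t, D^[s] (v i) := by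
    induction s with
    | zero => rfl
    | succ s ih => simp only [Function.iterate_succ_apply', ih, map_sum]
  rw [h]
  exact BoundedCombination.sum hρ (by positivity) _ fun i hi => hv i hi s

/-- In the Leibniz formula the binomial coefficient combines with `|i!|` from `f` and `|j!|` from
`v` into exactly `|s!|`. The factor `ρ^(-i)` from differentiating `f` is at most `r^(-i)` because `r
≤ ρ`, so the constant does not depend on `s`. -/
theorem IteratesBound.smul
    (hD : ∀ (f : AnalyticRing I) (v : M), D (f • v) = f.deriv • v + f • D v)
    (hr : 0 < r) (hrρ : r ≤ ρ) (hC : 0 ≤ C) {v : M} (hv : IteratesBound I D e ρ r C v)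
    {f : AnalyticRing I} {A : ℝ} (hf : f.NormLE ρ A) :
    IteratesBound I D e ρ r (A * C) (f • v) := fun s => by
  have hρ : 0 < ρ := hr.trans_le hrρ
  have hA := hf.nonneg
  rw [iterate_smul_eq_sum hD]
  refine BoundedCombination.sum hρ.le (by positivity) _ fun ⟨i, j⟩ hij => ?_
  rw [Finset.HasAntidiagonal.mem_antidiagonal] at hij
  simp only at hij ⊢
  subst hij
  -- The binomial coefficient is turned into a constant function so that its norm in `K` enters the
  -- estimate.
  rw [← Nat.cast_smul_eq_nsmul (AnalyticRing I), AnalyticRing.natCast_eq_monomial]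
  refine (((hv j).smul hρ (hf.deriv_iterate hρ i)).smul hρ
    (AnalyticRing.normLE_monomial hρ.le 0 _)).mono ?_
  have hfac : (((i + j).factorial : ℕ) : K) =
      ((i + j).choose i : K) * (i.factorial : K) * (j.factorial : K) := by
    have := Nat.add_choose_mul_factorial_mul_factorial i j
    rw [← Nat.choose_symm_add] at this
    rw [← this, Nat.cast_mul, Nat.cast_mul]
  have hpow : r ^ (-((i + j : ℕ) : ℤ)) = r ^ (-i : ℤ) * r ^ (-j : ℤ) := by
    rw [← zpow_add₀ hr.ne']; congr 1; push_cast; ring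
  have hle : ρ ^ (-i : ℤ) ≤ r ^ (-i : ℤ) := by
    rw [zpow_neg, zpow_neg, zpow_natCast, zpow_natCast]
    gcongr
  rw [hfac, norm_mul, norm_mul, hpow, zpow_zero, mul_one]
  calc ‖((i + j).choose i : K)‖ * (‖(i.factorial : K)‖ * ρ ^ (-i : ℤ) * A *
        (C * ‖(j.factorial : K)‖ * r ^ (-j : ℤ)))
      ≤ ‖((i + j).choose i : K)‖ * (‖(i.factorial : K)‖ * r ^ (-i : ℤ) * A *
        (C * ‖(j.factorial : K)‖ * r ^ (-j : ℤ))) := by gcongr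
    _ = _ := by ring

theorem IteratesBound.of_boundedCombination
    (hD : ∀ (f : AnalyticRing I) (v : M), D (f • v) = f.deriv • v + f • D v)
    (hr : 0 < r) (hrρ : r ≤ ρ) (hC : 0 ≤ C) (he : ∀ i, IteratesBound I D e ρ r C (e i))
    {v : M} {A : ℝ} (hA : 0 ≤ A) (hv : BoundedCombination I ρ e A v) :
    IteratesBound I D e ρ r (A * C) v := by
  obtain ⟨c, hc, rfl⟩ := hv
  exact IteratesBound.sum _ (hr.trans_le hrρ).le hr (by positivity)
    fun i _ => (he i).smul hD hr hrρ hC (hc i)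

/-- The growth of the iterates does not depend on the generating family. -/
theorem exists_iteratesBound_of_span_eq_top
    (hD : ∀ (f : AnalyticRing I) (v : M), D (f • v) = f.deriv • v + f • D v)
    (hρI : ρ ∈ Set.Icc I.left I.right) (hr : 0 < r) (hrρ : r ≤ ρ) (hC : 0 ≤ C)
    (he : ∀ i, IteratesBound I D e ρ r C (e i))
    (hspan : Submodule.span (AnalyticRing I) (Set.range e) = ⊤) {w : κ → M}
    (hw : Submodule.span (AnalyticRing I) (Set.range w) = ⊤) :
    ∃ C', 0 ≤ C' ∧ ∀ k, IteratesBound I D w ρ r C' (w k) := by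
  obtain ⟨A, hA, hwA⟩ := BoundedCombination.exists_of_span_eq_top hρI hspan w
  obtain ⟨B, hB, heB⟩ := BoundedCombination.exists_of_span_eq_top hρI hw e
  refine ⟨A * C * B, by positivity, fun k s => ?_⟩
  refine ((IteratesBound.of_boundedCombination hD hr hrρ hC he hA (hwA k) s).trans
    (hr.trans_le hrρ) (by positivity) hB heB).mono (le_of_eq ?_)
  ring

end Iterates

/-! ### Iterates of the connection on a Frobenius pullback -/

section FrobeniusPolynomial

open Polynomial

variable (p : ℕ) (K : Type*)

/-- The polynomial `(1 + X)^p - 1`. -/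
def frobPoly [Field K] : K[X] := (1 + X) ^ p - 1

/-- The coefficient of `t^(pj-s) F(D^j v)` in `D^s (F v)`. -/
def frobIterateCoeff [Field K] (s j : ℕ) : K :=
  (s.factorial : K) / (j.factorial : K) * (frobPoly p K ^ j).coeff s

variable {K}

/-- With `P = (1+X)^p - 1` one has `(1+X) P' = p (P + 1)`. Comparing coefficients of `X^s` yields
the recurrence that differentiation imposes on the coefficients of `D^s (F v)`. -/
theorem one_add_X_mul_derivative_frobPoly_pow [Field K] (hp : p ≠ 0) (j : ℕ) :
    (1 + X) * derivative (frobPoly p K ^ (j + 1)) =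
      ((p * (j + 1) : ℕ) : K[X]) * (frobPoly p K ^ (j + 1) + frobPoly p K ^ j) := by
  obtain ⟨q, rfl⟩ := Nat.exists_eq_succ_of_ne_zero hp
  have h : derivative (frobPoly (q + 1) K) = ((q + 1 : ℕ) : K[X]) * (1 + X) ^ q := by
    simp [frobPoly, derivative_pow]
  have h' : (1 + X) * (1 + X) ^ q = frobPoly (q + 1) K + 1 := by
    rw [frobPoly, ← pow_succ']; ring
  rw [derivative_pow, h]
  simp only [Nat.add_sub_cancel, map_natCast]
  push_cast
  linear_combination ((q + 1 : K[X]) * (j + 1) * frobPoly (q + 1) K ^ j) * h'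

theorem coeff_frobPoly_pow_succ [Field K] (hp : p ≠ 0) (s j : ℕ) :
    (s + 1 : K) * (frobPoly p K ^ (j + 1)).coeff (s + 1) =
      ((p : K) * (j + 1) - s) * (frobPoly p K ^ (j + 1)).coeff s +
        (p : K) * (j + 1) * (frobPoly p K ^ j).coeff s := by
  have h := congrArg (coeff · s) (one_add_X_mul_derivative_frobPoly_pow p (K := K) hp j)
  simp only [coeff_natCast_mul, coeff_add, add_mul, one_mul, coeff_derivative] at h
  have h2 : (X * derivative (frobPoly p K ^ (j + 1))).coeff s =
      s * (frobPoly p K ^ (j + 1)).coeff s := by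
    cases s with
    | zero => simp
    | succ s => rw [coeff_X_mul, coeff_derivative]; push_cast; ring
  rw [h2] at h
  push_cast at h
  linear_combination h

theorem coeff_frobPoly_pow_eq_zero [Field K] {s j : ℕ} (h : s < j) :
    (frobPoly p K ^ j).coeff s = 0 := by
  have h1 : X ∣ frobPoly p K := by
    rw [X_dvd_iff, frobPoly, coeff_zero_eq_eval_zero]; simp
  exact X_pow_dvd_iff.1 (pow_dvd_pow_of_dvd h1 j) s h

theorem frobIterateCoeff_eq_zero [Field K] {s j : ℕ} (h : s < j) :
    frobIterateCoeff p K s j = 0 := by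
  rw [frobIterateCoeff, coeff_frobPoly_pow_eq_zero p h, mul_zero]

theorem frobIterateCoeff_zero_zero [Field K] : frobIterateCoeff p K 0 0 = 1 := by
  simp [frobIterateCoeff]

theorem frobIterateCoeff_succ_zero [Field K] (s : ℕ) :
    frobIterateCoeff p K (s + 1) 0 = 0 := by
  simp [frobIterateCoeff, coeff_one]

theorem natCast_mul_frobIterateCoeff_zero [Field K] (s : ℕ) :
    (s : K) * frobIterateCoeff p K s 0 = 0 := by
  cases s with
  | zero => simp
  | succ s => rw [frobIterateCoeff_succ_zero, mul_zero]

theorem frobIterateCoeff_succ_succ [Field K] [CharZero K] (hp : p ≠ 0) (s j : ℕ) :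
    frobIterateCoeff p K (s + 1) (j + 1) =
      ((p : K) * (j + 1) - s) * frobIterateCoeff p K s (j + 1) +
        p * frobIterateCoeff p K s j := by
  have h := coeff_frobPoly_pow_succ p (K := K) hp s j
  have hj : (j.factorial : K) ≠ 0 := by exact_mod_cast j.factorial_ne_zero
  have hj' : (j + 1 : K) ≠ 0 := by exact_mod_cast j.succ_ne_zero
  simp only [frobIterateCoeff, Nat.factorial_succ]
  push_cast
  field_simp
  linear_combination (s.factorial : K) * h

variable [Fact p.Prime] [NormedField K] [IsUltrametricDist K] [PAdicallyNormalized p K]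

/-- The top term is `X^p`; each term of degree strictly between `0` and `p` has a coefficient
divisible by `p`, hence size at most `p⁻¹ u ≤ u^(p-1) u`. This is where the lower bound on `u` is
needed. -/
theorem norm_coeff_frobPoly_mul_pow_le {u : ℝ} (hu : 0 < u) (hu1 : u ≤ 1)
    (hup : (p : ℝ)⁻¹ ≤ u ^ (p - 1)) (s : ℕ) : ‖(frobPoly p K).coeff s‖ * u ^ s ≤ u ^ p := by
  have hp : p.Prime := Fact.out
  have hp0 := hp.pos
  rcases eq_or_ne s 0 with rfl | hs
  · rw [show (frobPoly p K).coeff 0 = 0 by simpa using coeff_frobPoly_pow_eq_zero p one_pos]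
    simp only [norm_zero, zero_mul]
    positivity
  have hc : (frobPoly p K).coeff s = (p.choose s : K) := by
    rw [frobPoly, coeff_sub, coeff_one_add_X_pow, coeff_one, if_neg hs, sub_zero]
  rw [hc]
  rcases lt_trichotomy s p with hsp | rfl | hsp
  · obtain ⟨c, hc⟩ := hp.dvd_choose_self hs hsp
    rw [hc, Nat.cast_mul, norm_mul, PAdicallyNormalized.norm_natCast]
    calc (p : ℝ)⁻¹ * ‖(c : K)‖ * u ^ s ≤ u ^ (p - 1) * 1 * u ^ 1 := by
          gcongr ?_ * ?_ * ?_
          · exact IsUltrametricDist.norm_natCast_le_one K c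
          · exact pow_le_pow_of_le_one hu.le hu1 (Nat.one_le_iff_ne_zero.2 hs)
      _ = u ^ p := by rw [mul_one, ← pow_add, Nat.sub_add_cancel hp.one_le]
  · simp
  · rw [Nat.choose_eq_zero_of_lt hsp]
    simp only [Nat.cast_zero, norm_zero, zero_mul]
    positivity

theorem norm_coeff_frobPoly_pow_mul_pow_le {u : ℝ} (hu : 0 < u) (hu1 : u ≤ 1)
    (hup : (p : ℝ)⁻¹ ≤ u ^ (p - 1)) (s j : ℕ) :
    ‖(frobPoly p K ^ j).coeff s‖ * u ^ s ≤ (u ^ p) ^ j := by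
  induction j generalizing s with
  | zero =>
    rcases eq_or_ne s 0 with rfl | hs
    · simp
    · simp [coeff_one, hs]
  | succ j ih =>
    rw [pow_succ, coeff_mul, pow_succ (u ^ p)]
    have h : ‖∑ x ∈ Finset.HasAntidiagonal.antidiagonal s,
        (frobPoly p K ^ j).coeff x.1 * (frobPoly p K).coeff x.2‖ ≤
          (u ^ p) ^ j * u ^ p * (u ^ s)⁻¹ := by
      refine IsUltrametricDist.norm_sum_le_of_forall_le_of_nonneg (by positivity)
        fun ⟨a, b⟩ hab => ?_
      rw [Finset.HasAntidiagonal.mem_antidiagonal] at hab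
      simp only at hab ⊢
      rw [norm_mul, ← div_eq_mul_inv, le_div_iff₀ (by positivity), ← hab, pow_add]
      calc _ = (‖(frobPoly p K ^ j).coeff a‖ * u ^ a) *
            (‖(frobPoly p K).coeff b‖ * u ^ b) := by ring
        _ ≤ _ := by
          gcongr
          · exact ih a
          · exact norm_coeff_frobPoly_mul_pow_le p hu hu1 hup b
    rwa [← div_eq_mul_inv, le_div_iff₀ (by positivity)] at h

end FrobeniusPolynomial

section FrobeniusPullback

variable {p : ℕ} [Fact p.Prime] {K : Type*} [NormedField K] [IsUltrametricDist K]
  [CompleteSpace K] [PAdicallyNormalized p K] {σ : CoefficientFrobenius p K}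
  {I : ClosedInterval K} {M N : Type*} [AddCommGroup M] [AddCommGroup N]
  [Module (AnalyticRing (I.pow p)) M] [Module (AnalyticRing I) N]
  {F : M →ₛₗ[standardFrobenius σ I] N} {DM : M →+ M} {DN : N →+ N}
  {ι : Type*} [Fintype ι] {e : ι → M} {ρ : ℝ}

theorem AnalyticRing.NormLE.standardFrobenius (hρ : 0 < ρ) {f : AnalyticRing (I.pow p)} {A : ℝ}
    (hf : f.NormLE (ρ ^ p) A) : (standardFrobenius σ I f).NormLE ρ A := fun n => by
  change ‖frobCoeff σ f.coeff n‖ * ρ ^ n ≤ A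
  by_cases hd : (p : ℤ) ∣ n
  · obtain ⟨m, rfl⟩ := hd
    rw [frobCoeff_mul_p, zpow_mul, zpow_natCast]
    refine le_trans ?_ (hf m)
    gcongr
    exact σ.norm_le _
  · rw [frobCoeff, if_neg hd, norm_zero, zero_mul]
    exact hf.nonneg

theorem BoundedCombination.frobenius (hρ : 0 < ρ) {A : ℝ} {v : M}
    (hv : BoundedCombination (I.pow p) (ρ ^ p) e A v) :
    BoundedCombination I ρ (fun i => F (e i)) A (F v) := by
  obtain ⟨c, hc, rfl⟩ := hv
  exact ⟨fun i => standardFrobenius σ I (c i), fun i => (hc i).standardFrobenius hρ, by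
    simp only [map_sum, map_smulₛₗ]⟩

variable [CharZero K]

/-- Taylor's formula for the substitution `t ↦ t^p`: formally `∑ D^s(F v) Y^s / s! = ∑ F(D^j v)
((t+Y)^p - t^p)^j / j!`, and `Y = tX` makes the last power `t^(pj) ((1+X)^p - 1)^j`. The proof is
the corresponding recurrence in `s`. The fixed bound `n ≥ s` keeps the index set constant during the
induction; terms with `j > s` vanish. -/
theorem iterate_frobenius_eq_sum
    (hDN : ∀ (f : AnalyticRing I) (v : N), DN (f • v) = f.deriv • v + f • DN v)
    (hF : ∀ v, DN (F v) = ((p : AnalyticRing I) * AnalyticRing.coord I ^ (p - 1)) • F (DM v))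
    (v : M) {s n : ℕ} (hs : s ≤ n) :
    DN^[s] (F v) = ∑ j ∈ Finset.range (n + 1),
      (AnalyticRing.monomial (p * j - s) (frobIterateCoeff p K s j) : AnalyticRing I) •
        F (DM^[j] v) := by
  have hp : p.Prime := Fact.out
  have hF' : ∀ v, DN (F v) =
      (AnalyticRing.monomial (p - 1) (p : K) : AnalyticRing I) • F (DM v) := fun v => by
    rw [hF, AnalyticRing.natCast_eq_monomial, AnalyticRing.coord_pow,
      AnalyticRing.monomial_mul_monomial, zero_add, mul_one, Nat.cast_sub hp.one_le, Nat.cast_one]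
  induction s with
  | zero =>
    rw [Finset.sum_range_succ', Finset.sum_eq_zero, zero_add, frobIterateCoeff_zero_zero]
    · simp [AnalyticRing.monomial_zero_one]
    · intro j _
      rw [frobIterateCoeff_eq_zero p j.succ_pos, AnalyticRing.monomial_zero_right, zero_smul]
  | succ s ih =>
    rw [Function.iterate_succ_apply', ih (by omega)]
    simp only [map_sum, hDN, hF', AnalyticRing.deriv_monomial, smul_smul,
      AnalyticRing.monomial_mul_monomial, Finset.sum_add_distrib, ← Function.iterate_succ_apply']
    -- The sum from differentiating the monomials loses its term `j = 0`, the sum from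
    -- differentiating `F (D^j v)` loses its top term `j = n` (zero as `s < n`), and the target
    -- loses `j = 0`; the remaining indices then match the recurrence.
    rw [Finset.sum_range_succ' _ n, Finset.sum_range_succ _ n, Finset.sum_range_succ' _ n,
      frobIterateCoeff_eq_zero p (by omega : s < n), frobIterateCoeff_succ_zero]
    simp only [zero_mul, AnalyticRing.monomial_zero_right, zero_smul, add_zero]
    have h0 : (((p : ℤ) * ((0 : ℕ) : ℤ) - s : ℤ) : K) * frobIterateCoeff p K s 0 = 0 := by
      have := natCast_mul_frobIterateCoeff_zero p (K := K) s
      push_cast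
      linear_combination -this
    rw [h0, AnalyticRing.monomial_zero_right, zero_smul, add_zero, ← Finset.sum_add_distrib]
    refine Finset.sum_congr rfl fun j _ => ?_
    rw [← add_smul, frobIterateCoeff_succ_succ p hp.ne_zero, AnalyticRing.monomial_add]
    congr 2
    · congr 1
      · push_cast; ring
      · push_cast; ring
    · congr 1
      · push_cast; ring
      · ring

/-- Frobenius improves the radius of convergence `(u ρ)^p` on the circle `|t| = ρ^p` to `u ρ` on
the circle `|t| = ρ`. -/
theorem IteratesBound.frobenius
    (hDN : ∀ (f : AnalyticRing I) (v : N), DN (f • v) = f.deriv • v + f • DN v)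
    (hF : ∀ v, DN (F v) = ((p : AnalyticRing I) * AnalyticRing.coord I ^ (p - 1)) • F (DM v))
    {u C : ℝ} (hρ : 0 < ρ) (hu : 0 < u) (hu1 : u ≤ 1) (hup : (p : ℝ)⁻¹ ≤ u ^ (p - 1))
    (hC : 0 ≤ C) {v : M} (hv : IteratesBound (I.pow p) DM e (ρ ^ p) (u ^ p * ρ ^ p) C v) :
    IteratesBound I DN (fun i => F (e i)) ρ (u * ρ) C (F v) := fun s => by
  rw [iterate_frobenius_eq_sum hDN hF v le_rfl]
  refine BoundedCombination.sum hρ.le (by positivity) _ fun j _ => ?_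
  refine (((hv j).frobenius (F := F) hρ).smul hρ
    (AnalyticRing.normLE_monomial hρ.le _ _)).mono ?_
  have hj : ‖(j.factorial : K)‖ ≠ 0 := by
    rw [norm_ne_zero_iff]; exact_mod_cast j.factorial_ne_zero
  -- In the term of index `j`, the `|j!|` bounding `D^j v` cancels the denominator of
  -- `frobIterateCoeff`, and the Gauss norm bound `u^(pj) u^(-s)` absorbs the factor `(u^p)^(-j)`,
  -- leaving `C |s!| (uρ)^(-s)`.
  have hb := norm_coeff_frobPoly_pow_mul_pow_le p (K := K) hu hu1 hup s j
  have h1 : ρ ^ ((p : ℤ) * j - s) = (ρ ^ p) ^ j * (ρ ^ s)⁻¹ := by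
    rw [zpow_sub₀ hρ.ne', zpow_mul, zpow_natCast, zpow_natCast, zpow_natCast, div_eq_mul_inv]
  rw [frobIterateCoeff, norm_mul, norm_div, h1, zpow_neg, zpow_neg, zpow_natCast, zpow_natCast,
    mul_pow, mul_pow]
  have hup0 : (0 : ℝ) < (u ^ p) ^ j := by positivity
  calc _ = C * ‖(s.factorial : K)‖ * (ρ ^ s)⁻¹ * ((u ^ s)⁻¹ * ((u ^ p) ^ j)⁻¹) *
        (‖(frobPoly p K ^ j).coeff s‖ * u ^ s) := by field_simp
    _ ≤ C * ‖(s.factorial : K)‖ * (ρ ^ s)⁻¹ * ((u ^ s)⁻¹ * ((u ^ p) ^ j)⁻¹) * (u ^ p) ^ j := by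
        gcongr
    _ = _ := by field_simp

end FrobeniusPullback

/-! ### The initial radius given by a stable lattice. -/

section StableLattice

variable (p : ℕ) [Fact p.Prime] {K : Type u} [NormedField K] [IsUltrametricDist K]
  [CompleteSpace K] [PAdicallyNormalized p K] {ε : ℝ}

/-- A lattice stable under `t d/dt` is stable under `t^s (d/dt)^s`. -/
theorem coord_pow_smul_iterate_mem (E : NablaModule.{u, v} K ε) {I : ClosedInterval K}
    {hI : ε ≤ I.left} {L : Submodule (AnalyticRing.integral I) (E.sections I hI)}
    (hL : ∀ v ∈ L, AnalyticRing.coord I • E.D I hI v ∈ L) {v : E.sections I hI} (hv : v ∈ L)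
    (s : ℕ) : AnalyticRing.coord I ^ s • (E.D I hI)^[s] v ∈ L := by
  induction s with
  | zero => simpa using hv
  | succ s ih =>
    have h1 := hL _ ih
    -- Hence `t D (t^s D^s v) = s t^s D^s v + t^(s+1) D^(s+1) v`, and the first summand already lies
    -- in `L`.
    have h2 : AnalyticRing.coord I * (AnalyticRing.coord I ^ s).deriv =
        (s : AnalyticRing I) * AnalyticRing.coord I ^ s := by
      rw [AnalyticRing.coord_pow, AnalyticRing.natCast_eq_monomial,
        ← AnalyticRing.monomial_one_one, AnalyticRing.deriv_monomial,
        AnalyticRing.monomial_mul_monomial, AnalyticRing.monomial_mul_monomial]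
      congr 1
      · ring
      · push_cast; ring
    rw [E.leibniz, smul_add, smul_smul, smul_smul, ← pow_succ', h2, mul_smul,
      Nat.cast_smul_eq_nsmul] at h1
    rw [Function.iterate_succ_apply']
    exact (add_mem_cancel_left (nsmul_mem ih s)).1 h1

/-- For lattice generators the coefficients of `t^s D^s e_i` are bounded by `1`. Dividing by `t^s`
gives `ρ^(-s)`, and this is at most `|s!| (expRadius p · ρ)^(-s)` by the lower bound for `|s!|`. -/
theorem exists_iteratesBound_of_hasStableLattices (E : NablaModule.{u, v} K ε)
    (hE : E.HasStableLattices) (I : ClosedInterval K) (hI : ε ≤ I.left) :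
    ∃ (n : ℕ) (e : Fin n → E.sections I hI),
      Submodule.span (AnalyticRing I) (Set.range e) = ⊤ ∧
        ∃ C, 0 ≤ C ∧ ∀ i, IteratesBound I (E.D I hI) e I.left (expRadius p * I.left) C (e i) := by
  obtain ⟨L, ⟨hfg, hspan⟩, hstab⟩ := hE I hI
  obtain ⟨n, e, he⟩ := Submodule.fg_iff_exists_fin_generating_family.1 hfg
  have hLe : (L : Set (E.sections I hI)) ⊆ Submodule.span (AnalyticRing I) (Set.range e) := by
    rw [← he]
    exact Submodule.span_subset_span _ _ _
  have hρ := I.left_pos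
  have hr := expRadius_pos p
  refine ⟨n, e, top_unique (hspan ▸ Submodule.span_le.2 hLe), 1, zero_le_one, fun i s => ?_⟩
  have hi : e i ∈ L := he ▸ Submodule.subset_span ⟨i, rfl⟩
  have hmem := coord_pow_smul_iterate_mem E hstab hi s
  rw [← he, Submodule.mem_span_range_iff_exists_fun] at hmem
  obtain ⟨c, hc⟩ := hmem
  have hb : BoundedCombination I I.left e 1
      (AnalyticRing.coord I ^ s • (E.D I hI)^[s] (e i)) :=
    ⟨fun j => (c j : AnalyticRing I), fun j =>
      (c j).2 I.left (AnalyticRing.left_mem_Icc I), hc.symm⟩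
  have hb' := hb.smul hρ
    (AnalyticRing.normLE_monomial (I := I) hρ.le (-s : ℤ) (1 : K))
  rw [smul_smul, AnalyticRing.coord_pow, AnalyticRing.monomial_mul_monomial, neg_add_cancel,
    mul_one (1 : K), AnalyticRing.monomial_zero_one, one_smul] at hb'
  refine hb'.mono ?_
  rw [norm_one, one_mul, one_mul, mul_one, zpow_neg, zpow_neg, zpow_natCast, zpow_natCast,
    mul_pow, mul_inv, ← mul_assoc]
  refine le_mul_of_one_le_left (by positivity) ?_
  rw [← div_eq_mul_inv, one_le_div (by positivity)]
  exact expRadius_pow_le_norm_factorial p K s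

end StableLattice

/-! ### Iterating Frobenius. -/

section Descent

variable {p : ℕ} [Fact p.Prime] {K : Type u} [NormedField K] [IsUltrametricDist K]
  [CompleteSpace K] [CharZero K] [PAdicallyNormalized p K] {ε : ℝ}
  {σ : CoefficientFrobenius p K}

/-- The condition on `u` under which `IteratesBound.frobenius` applies: raising `u ≤ 1` to the
larger exponent `p^(k+1) (p-1)` already gives `p⁻¹`. -/
theorem inv_le_pow_of_pow_eq_expRadius {u : ℝ} (hu : 0 < u) (hu1 : u ≤ 1) {k : ℕ}
    (h : u ^ p ^ (k + 1) = expRadius p) : (p : ℝ)⁻¹ ≤ u ^ (p - 1) := by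
  have hp : p.Prime := Fact.out
  rw [← expRadius_pow p, ← h, ← pow_mul]
  exact pow_le_pow_of_le_one hu.le hu1
    (Nat.le_mul_of_pos_left _ (pow_pos hp.pos _))

/-- Pushing the bound coming from the stable lattices towards the outer boundary by iterating the
Frobenius structure. -/
theorem exists_iteratesBound_of_pow_eq (E : NablaModule.{u, v} K ε) (F : FrobeniusStructure σ E)
    (hE : E.HasStableLattices) (k : ℕ) (I : ClosedInterval K) (hI : ε ≤ I.left)
    (hIk : I.left ^ p ^ k = ε) {u : ℝ} (hu : 0 < u) (huk : u ^ p ^ k = expRadius p) :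
    ∃ (n : ℕ) (e : Fin n → E.sections I hI),
      Submodule.span (AnalyticRing I) (Set.range e) = ⊤ ∧
        ∃ C, 0 ≤ C ∧ ∀ i, IteratesBound I (E.D I hI) e I.left (u * I.left) C (e i) := by
  have hp : p.Prime := Fact.out
  induction k generalizing I u with
  | zero =>
    rw [pow_zero, pow_one] at huk
    rw [huk]
    exact exists_iteratesBound_of_hasStableLattices p E hE I hI
  | succ k ih =>
    have hu1 : u ≤ 1 := by
      refine (pow_le_one_iff_of_nonneg hu.le (pow_ne_zero (k + 1) hp.ne_zero)).1 ?_
      rw [huk]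
      exact expRadius_le_one p
    have hIk' : (I.pow p).left ^ p ^ k = ε := by
      rw [← hIk, pow_succ', pow_mul]; rfl
    have hI' : ε ≤ (I.pow p).left := by
      rw [← hIk']
      exact pow_le_of_le_one (I.pow p).left_pos.le
        ((I.pow p).left_le_right.trans (I.pow p).right_lt_one.le) (pow_ne_zero k hp.ne_zero)
    obtain ⟨n, e, hspan, C, hC, he⟩ := ih (I.pow p) hI' hIk' (u := u ^ p) (pow_pos hu p) (by
      rw [← huk, pow_succ', pow_mul])
    exact ⟨n, fun i => F.F I hI' (e i), (F.baseChange I hI').span_range_eq_top hspan, C, hC,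
      fun i => (he i).frobenius (E.leibniz I _) (F.D_F I hI') I.left_pos hu hu1
        (inv_le_pow_of_pow_eq_expRadius hu hu1 huk) hC⟩

end Descent

/-! ### From growth of iterates to the generic radius. -/

section Radius

variable {p : ℕ} [Fact p.Prime] {K : Type u} [NormedField K] [IsUltrametricDist K]
  [CompleteSpace K] [PAdicallyNormalized p K] {ε : ℝ}

/-- The restriction of the iterated bound on a smaller annulus to the norms computed in a basis. -/
theorem exists_iterateNorm_le (E : NablaModule.{u, v} K ε) {I J : ClosedInterval K}
    (hI : ε ≤ I.left) (hJI : J.Sub I) {ρ r C : ℝ} (hρJ : ρ ∈ Set.Icc J.left J.right)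
    (hr : 0 < r) (hrρ : r ≤ ρ) (hC : 0 ≤ C) {m : ℕ}
    {w : Fin m → E.sections J (hI.trans hJI.1)}
    (hspan : Submodule.span (AnalyticRing J) (Set.range w) = ⊤)
    (hw : ∀ i, IteratesBound J (E.D J (hI.trans hJI.1)) w ρ r C (w i)) {n : ℕ}
    (e : Module.Basis (Fin n) (AnalyticRing I) (E.sections I hI)) :
    ∃ A, 0 ≤ A ∧ ∀ s, E.iterateNorm e ρ s ≤ A * ‖((s.factorial : ℕ) : K)‖ * r ^ (-s : ℤ) := by
  have hbc := E.res_baseChange hI hJI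
  obtain ⟨A, hA, he⟩ := exists_iteratesBound_of_span_eq_top (E.leibniz J _) hρJ hr hrρ hC hw
    hspan (hbc.span_range_eq_top e.span_eq)
  have hD : ∀ (s : ℕ) (v : E.sections I hI), (E.D J (hI.trans hJI.1))^[s] (E.res hI hJI v) =
      E.res hI hJI ((E.D I hI)^[s] v) := fun s v => by
    induction s with
    | zero => rfl
    | succ s ih =>
      rw [Function.iterate_succ_apply', Function.iterate_succ_apply', ih, E.D_res]
  refine ⟨A, hA, fun s => Real.iSup_le (fun q => ?_) (by positivity)⟩
  obtain ⟨c, hc, hsum⟩ := he q.2 s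
  rw [hD, ← e.sum_repr ((E.D I hI)^[s] (e q.2)), map_sum] at hsum
  simp only [map_smulₛₗ] at hsum
  -- The restricted basis is still independent, so the bounded coefficients are the restrictions of
  -- the coordinates in `e`. Restriction does not change Laurent coefficients, so the bound holds
  -- for the coordinates themselves.
  have hcq := Fintype.linearIndependent_iffₛ.1 (hbc.linearIndependent e) _ _ hsum q.1
  have hq := hc q.1
  rw [← hcq] at hq
  exact AnalyticRing.NormLE.gaussNorm_le (I := I) hq

theorem limsup_iterateNorm_le (E : NablaModule.{u, v} K ε) {I : ClosedInterval K}
    {hI : ε ≤ I.left} {n : ℕ} (e : Module.Basis (Fin n) (AnalyticRing I) (E.sections I hI))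
    {ρ r A : ℝ} (hρ : 0 < ρ) (hr : 0 < r) (hA : 0 ≤ A)
    (h : ∀ s, E.iterateNorm e ρ s ≤ A * ‖((s.factorial : ℕ) : K)‖ * r ^ (-s : ℤ)) :
    limsup (fun s : ℕ => E.iterateNorm e ρ s ^ (1 / (s : ℝ))) atTop ≤ expRadius p / r := by
  have hp : (0 : ℝ) < p := by exact_mod_cast (Fact.out : p.Prime).pos
  have hx := expRadius_pos p
  have hnn : ∀ s, 0 ≤ E.iterateNorm e ρ s := fun s => Real.iSup_nonneg fun q =>
    Real.iSup_nonneg fun i => by positivity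
  -- `A + 1` replaces `A`, which may be `0`: the base must be nonzero for its `s`-th root to tend to
  -- `1`.
  have h1 : Tendsto (fun s : ℕ => ((A + 1) * p) ^ (1 / (s : ℝ))) atTop (𝓝 1) := by
    have := (Real.continuousAt_const_rpow (a := (A + 1) * p) (b := 0) (by positivity)).tendsto.comp
      tendsto_one_div_atTop_nhds_zero_nat
    simpa [Function.comp_def] using this
  have h2 : Tendsto (fun s : ℕ => (s : ℝ) ^ (1 / (s : ℝ))) atTop (𝓝 1) :=
    tendsto_rpow_div.comp tendsto_natCast_atTop_atTop
  have h3 : Tendsto (fun s : ℕ => ((A + 1) * p) ^ (1 / (s : ℝ)) * (s : ℝ) ^ (1 / (s : ℝ)) *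
      (expRadius p / r)) atTop (𝓝 (expRadius p / r)) := by
    simpa using (h1.mul h2).mul_const (expRadius p / r)
  have hle : (fun s : ℕ => E.iterateNorm e ρ s ^ (1 / (s : ℝ))) ≤ᶠ[atTop]
      fun s : ℕ => ((A + 1) * p) ^ (1 / (s : ℝ)) * (s : ℝ) ^ (1 / (s : ℝ)) *
        (expRadius p / r) := by
    filter_upwards [eventually_ne_atTop 0] with s hs
    have hb : E.iterateNorm e ρ s ≤ (A + 1) * p * s * (expRadius p / r) ^ s := by
      calc E.iterateNorm e ρ s ≤ A * ‖((s.factorial : ℕ) : K)‖ * r ^ (-s : ℤ) := h s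
        _ ≤ (A + 1) * (p * s * expRadius p ^ s) * r ^ (-s : ℤ) := by
            gcongr
            · linarith
            · exact norm_factorial_le p K hs
        _ = _ := by rw [div_pow, zpow_neg, zpow_natCast]; ring
    refine (Real.rpow_le_rpow (hnn s) hb (by positivity)).trans (le_of_eq ?_)
    rw [Real.mul_rpow (by positivity) (by positivity), Real.mul_rpow (by positivity)
      (by positivity), one_div, Real.pow_rpow_inv_natCast (by positivity) hs]
  rw [← h3.limsup_eq]
  refine limsup_le_limsup hle ?_ h3.isBoundedUnder_le
  -- Nonnegativity of the sequence supplies the coboundedness that comparing real limsups requires.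
  exact IsBoundedUnder.isCoboundedUnder_le
    ⟨0, eventually_map.2 (Eventually.of_forall fun s => Real.rpow_nonneg (hnn s) _)⟩

/-- `R` comes with an unspecified annulus and basis, so the estimate is made for all of them at
once. `J` is a single circle and therefore lies in every annulus containing its radius. -/
theorem le_of_isGenericRadius (E : NablaModule.{u, v} K ε) {J : ClosedInterval K}
    (hJ : ε ≤ J.left) (hJJ : J.left = J.right) {r C : ℝ} (hr : 0 < r) (hrρ : r ≤ J.left)
    (hC : 0 ≤ C) {m : ℕ} {w : Fin m → E.sections J hJ}
    (hspan : Submodule.span (AnalyticRing J) (Set.range w) = ⊤)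
    (hw : ∀ i, IteratesBound J (E.D J hJ) w J.left r C (w i)) {R : ℝ}
    (hR : E.IsGenericRadius p J.left R) : r ≤ R := by
  obtain ⟨I, hI, n, e, hρI, rfl⟩ := hR
  have hJI : J.Sub I := ⟨hρI.1, hJJ ▸ hρI.2⟩
  obtain ⟨A, hA, hle⟩ := exists_iterateNorm_le E hI hJI (AnalyticRing.left_mem_Icc J) hr hrρ hC
    hspan hw e
  have hx := expRadius_pos p
  have hρ := J.left_pos
  have hS : E.spectralNorm p e J.left ≤ expRadius p / r := by
    -- The first entry of the maximum is harmless because `r ≤ ρ`.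
    refine max_le ?_ (limsup_iterateNorm_le E e hρ hr hA hle)
    change expRadius p * J.left⁻¹ ≤ _
    rw [div_eq_mul_inv]
    gcongr
  have hS0 : 0 < E.spectralNorm p e J.left :=
    lt_max_of_lt_left (mul_pos hx (inv_pos.2 hρ))
  change r ≤ expRadius p * _
  rw [← div_eq_mul_inv, le_div_iff₀ hS0]
  calc r * E.spectralNorm p e J.left ≤ r * (expRadius p / r) := by gcongr
    _ = expRadius p := by field_simp

end Radius

/-! ### Comparison with the highest break. -/

/-- The circle `|t| = ρ`. -/
def ClosedInterval.circle {K : Type*} [NormedField K] {ρ : ℝ} (h1 : ρ < 1)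
    (h : ρ ∈ divisibleValueGroup K) : ClosedInterval K where
  left := ρ
  right := ρ
  left_pos := h.1
  left_le_right := le_rfl
  right_lt_one := h1
  left_mem := h
  right_mem := h

theorem mem_divisibleValueGroup_of_pow {K : Type*} [NormedField K] {r : ℝ} (hr : 0 < r) {m : ℕ}
    (hm : 0 < m) (h : r ^ m ∈ divisibleValueGroup K) : r ∈ divisibleValueGroup K := by
  obtain ⟨_, n, hn, x, hx, hxr⟩ := h
  exact ⟨hr, m * n, Nat.mul_pos hm hn, x, hx, by rw [pow_mul, hxr]⟩

/-- The highest break is bounded by comparing the radii at `ε^(1/p^k)` for large `k`. -/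
theorem expRadius_le_rpow {p : ℕ} [Fact p.Prime] {K : Type u} [NormedField K]
    [IsUltrametricDist K] [CompleteSpace K] [CharZero K] [PAdicallyNormalized p K] {ε : ℝ}
    {σ : CoefficientFrobenius p K} (hε : ε ∈ Set.Ioo (0 : ℝ) 1)
    (hεmem : ε ∈ divisibleValueGroup K) (E : NablaModule.{u, v} K ε)
    (F : FrobeniusStructure σ E) (hL : E.HasStableLattices) {β : ℝ}
    (hβ : E.HighestBreakGE p β) : expRadius p ≤ ε ^ β := by
  have hp : p.Prime := Fact.out
  obtain ⟨ρ₀, hρ₀, hbreak⟩ := hβ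
  have hlim : Tendsto (fun k : ℕ => ε ^ (1 / ((p ^ k : ℕ) : ℝ))) atTop (𝓝 1) := by
    have h1 : Tendsto (fun k : ℕ => 1 / ((p ^ k : ℕ) : ℝ)) atTop (𝓝 0) :=
      tendsto_one_div_atTop_nhds_zero_nat.comp (tendsto_pow_atTop_atTop_of_one_lt hp.one_lt)
    simpa [Function.comp_def] using
      (Real.continuousAt_const_rpow (a := ε) (b := 0) hε.1.ne').tendsto.comp h1
  obtain ⟨k, hk⟩ := (hlim.eventually_const_lt hρ₀.2).exists
  have hq : p ^ k ≠ 0 := pow_ne_zero k hp.ne_zero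
  set ρ : ℝ := ε ^ (1 / ((p ^ k : ℕ) : ℝ)) with hρdef
  have hρ : 0 < ρ := Real.rpow_pos_of_pos hε.1 _
  have hρk : ρ ^ p ^ k = ε := by
    rw [hρdef, one_div, Real.rpow_inv_natCast_pow hε.1.le hq]
  have hρ1 : ρ < 1 := Real.rpow_lt_one hε.1.le hε.2 (by positivity)
  have hρmem : ρ ∈ divisibleValueGroup K :=
    mem_divisibleValueGroup_of_pow hρ (Nat.pos_of_ne_zero hq) (hρk ▸ hεmem)
  set u : ℝ := expRadius p ^ (1 / ((p ^ k : ℕ) : ℝ)) with hudef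
  have hu : 0 < u := Real.rpow_pos_of_pos (expRadius_pos p) _
  have huk : u ^ p ^ k = expRadius p := by
    rw [hudef, one_div, Real.rpow_inv_natCast_pow (expRadius_pos p).le hq]
  have hu1 : u ≤ 1 := Real.rpow_le_one (expRadius_pos p).le (expRadius_le_one p) (by positivity)
  have hερ : ε ≤ ρ := hρk ▸ pow_le_of_le_one hρ.le hρ1.le hq
  let J := ClosedInterval.circle hρ1 hρmem
  obtain ⟨m, w, hspan, C, hC, hw⟩ := exists_iteratesBound_of_pow_eq E F hL k J hερ hρk hu huk
  obtain ⟨R, hR, hRle⟩ := hbreak ρ ⟨⟨hk, hρ1⟩, hρmem⟩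
  have hle : u * ρ ≤ R := le_of_isGenericRadius E (J := J) hερ rfl (mul_pos hu hρ)
    (mul_le_of_le_one_left hρ.le hu1) hC hspan hw hR
  have huρ : u ≤ ρ ^ β := by
    refine le_of_mul_le_mul_right (hle.trans (hRle.trans (le_of_eq ?_))) hρ
    rw [Real.rpow_add_one hρ.ne']
  -- The `p^k`-th power eliminates `k`, so a single large `k` suffices and no limit is taken.
  calc expRadius p = u ^ p ^ k := huk.symm
    _ ≤ (ρ ^ β) ^ p ^ k := by gcongr
    _ = ε ^ β := by
      rw [← hρk, ← Real.rpow_natCast, ← Real.rpow_natCast, ← Real.rpow_mul hρ.le,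
        ← Real.rpow_mul hρ.le, mul_comm]

end RigidAnnulus

end

theorem propositionP (p : ℕ) [Fact p.Prime]
    (K : Type u) [NormedField K] [IsUltrametricDist K] [CompleteSpace K] [CharZero K]
    [RigidAnnulus.PAdicallyNormalized p K]
    (σ : RigidAnnulus.CoefficientFrobenius p K)
    (ε : ℝ) (hε : ε ∈ Set.Ioo (0 : ℝ) 1) (hεmem : ε ∈ RigidAnnulus.divisibleValueGroup K)
    (E : RigidAnnulus.NablaModule.{u, v} K ε)
    (F : RigidAnnulus.FrobeniusStructure σ E)
    (hL : E.HasStableLattices)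
    (β : ℝ) (hβ : E.HasHighestBreak p β) :
    β ≤ 1 / (((p : ℝ) - 1) * Real.logb p ε⁻¹) := by
  have hp : (1 : ℝ) < p := by exact_mod_cast (Fact.out : p.Prime).one_lt
  have h := RigidAnnulus.expRadius_le_rpow hε hεmem E F hL hβ.2.2
  -- In base `p` this reads `-1/(p-1) ≤ β log_p ε`.
  have hlog := Real.logb_le_logb_of_le hp (RigidAnnulus.expRadius_pos p) h
  rw [RigidAnnulus.expRadius, Real.logb_rpow (by positivity) hp.ne',
    Real.logb_rpow_eq_mul_logb_of_pos hε.1] at hlog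
  have hpos : 0 < Real.logb p ε⁻¹ := Real.logb_pos hp ((one_lt_inv₀ hε.1).2 hε.2)
  have hp1 : 0 < (p : ℝ) - 1 := by linarith
  rw [le_div_iff₀ (mul_pos hp1 hpos)]
  rw [Real.logb_inv]
  have h2 : β * -Real.logb p ε ≤ 1 / ((p : ℝ) - 1) := by linarith
  rw [le_div_iff₀ hp1] at h2
  linarith
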